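/- **Setting.** Let $\alpha>1$ denote the energy exponent. An instance of uniform speed scaling is a triple $(w,D,T)$ with integers $1\le D\le T$ and $w=(w_0,\dots,w_{T-D})$ a vector of nonnegative real workloads. A feasible schedule consists of measurable speed functions $s_i\ge 0$, $0\le i\le T-D$, where $s_i$ vanishes outside $[i,i+D]$ and $\int_i^{i+D}s_i(t)\,dt=w_i$. Its cost is $\int_0^T\big(\sum_i s_i(t)\big)^\alpha dt$, and $\mathrm{OPT}(w)$ is the optimal (infimum) cost over all feasible schedules. A learning-augmented online algorithm receives $D$, $T$ and a predicted workload vector $w^{\mathrm{pred}}$ in advance and outputs a feasible schedule of the actual workload vector $w^{\mathrm{real}}$, where its speeds at time $t$ depend only on $D$, $T$, $w^{\mathrm{pred}}$ and the workloads $w^{\mathrm{real}}_j$ with $j\le t$. It is monotone if, for fixed $D$, $T$ and $w^{\mathrm{pred}}$, its cost on $w$ is at least its cost on $w'$ whenever $w\ge w'$ coordinate-wise. Put $\mathrm{err}(w,w')=\sum_i|w_i-w'_i|^\alpha$. For $\eta\ge 0$ write $w\in N_\eta(w')$ if there are $x_{ij}\ge 0$ $(0\le i,j\le T-D)$ with $x_{ij}=0$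 whenever $|i-j|>\eta D$, $w_i=\sum_j x_{ij}$ for all $i$, and $w'_j=\sum_i x_{ij}$ for all $j$; and let $$\mathrm{err}_\eta(w^{\mathrm{real}},w^{\mathrm{pred}})=\min_{w\in N_\eta(w^{\mathrm{pred}})}\mathrm{err}(w^{\mathrm{real}},w).$$ **Theorem.** There are absolute constants $c_1,c_2>0$ and a conversion that turns every learning-augmented online algorithm $\mathcal A$, for all parameters $\eta\ge0$ and $\zeta>0$, into a learning-augmented online algorithm $\textsc{Noise-Robust}(\mathcal A)$ (depending only on $\mathcal A,\eta,\zeta$) such that the following holds for every $\alpha>1$. Suppose that $\mathcal A$ is monotone and that, for constants $C,C',C''\ge 0$, its schedule has cost at most $$\min\{C\cdot\mathrm{OPT}(w^{\mathrm{real}})+C'\cdot\mathrm{err}(w^{\mathrm{real}},w^{\mathrm{pred}}),\;C''\cdot\mathrm{OPT}(w^{\mathrm{real}})\}$$ for all $D,T,w^{\mathrm{pred}},w^{\mathrm{real}}$. Then, for all $\eta\ge 0$, $\zeta>0$ and all $D,T,w^{\mathrm{pred}},w^{\mathrm{real}}$, the schedule of $\textsc{Noise-Robust}(\mathcal A)$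 has cost at most $$\big((1+\eta)(1+\zeta)\big)^{c_1\alpha}\cdot\min\Big\{C\cdot\mathrm{OPT}(w^{\mathrm{real}})+(1/\zeta)^{c_2\alpha}\,(C+C')\,\mathrm{err}_\eta(w^{\mathrm{real}},w^{\mathrm{pred}}),\;C''\cdot\mathrm{OPT}(w^{\mathrm{real}})\Big\}.$$ -/

import Mathlib

open scoped NNReal ENNReal

namespace SpeedScaling

/-- The workload vector of an instance `(w, D, T)`: one nonnegative real amount of work for each
release time `i ∈ {0, …, T - D}`. (Instances are only ever considered for `0 < D ≤ T`.) -/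
abbrev Workload (D T : ℕ) : Type := Fin (T - D + 1) → ℝ≥0

/-- A family of speed functions: `s i t` is the speed at which job `i` is processed at time `t`. -/
abbrev Schedule (D T : ℕ) : Type := Fin (T - D + 1) → ℝ → ℝ≥0

/-- `s` is a feasible schedule of `(w, D, T)`: each job `i` is processed at a measurable speed,
only during `[i, i + D]`, and receives exactly `w i` units of work there. -/
def Feasible {D T : ℕ} (w : Workload D T) (s : Schedule D T) : Prop :=
  ∀ i : Fin (T - D + 1),
    Measurable (s i) ∧
    (∀ t : ℝ, t ∉ Set.Icc ((i : ℕ) : ℝ) (((i : ℕ) : ℝ) + D) → s i t = 0) ∧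
    ∫⁻ t in Set.Icc ((i : ℕ) : ℝ) (((i : ℕ) : ℝ) + D), (s i t : ℝ≥0∞) = (w i : ℝ≥0∞)

/-- The energy `∫_0^T (∑ i, s_i(t)) ^ α dt` of a schedule, possibly infinite. -/
noncomputable def cost (α : ℝ) {D T : ℕ} (s : Schedule D T) : ℝ≥0∞ :=
  ∫⁻ t in Set.Icc (0 : ℝ) (T : ℝ), (∑ i, (s i t : ℝ≥0∞)) ^ α

/-- The optimal offline energy of the instance `(w, D, T)`. -/
noncomputable def OPT (α : ℝ) {D T : ℕ} (w : Workload D T) : ℝ≥0∞ :=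
  ⨅ (s : Schedule D T) (_ : Feasible w s), cost α s

/-- The prediction error `∑ i, |w_i - w'_i| ^ α`. -/
noncomputable def err (α : ℝ) {D T : ℕ} (w w' : Workload D T) : ℝ≥0∞ :=
  ∑ i, ENNReal.ofReal (|(w i : ℝ) - (w' i : ℝ)| ^ α)

/-- `w ∈ N_η(w')`: `w` is obtained from `w'` by moving (nonnegative amounts of) work by at most
`η D` time steps. The amount `x i j` is the part of `w i` that is located at `j` in `w'`. -/
def IsNeighbor (η : ℝ) {D T : ℕ} (w w' : Workload D T) : Prop :=
  ∃ x : Fin (T - D + 1) → Fin (T - D + 1) → ℝ≥0,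
    (∀ i j : Fin (T - D + 1), η * (D : ℝ) < |((i : ℕ) : ℝ) - ((j : ℕ) : ℝ)| → x i j = 0) ∧
    (∀ i, w i = ∑ j, x i j) ∧
    (∀ j, w' j = ∑ i, x i j)

/-- The `η`-prediction error: the least error between `real` and a vector in `N_η(pred)`. -/
noncomputable def errShift (α η : ℝ) {D T : ℕ} (real pred : Workload D T) : ℝ≥0∞ :=
  ⨅ (w : Workload D T) (_ : IsNeighbor η w pred), err α real w

/-- A (deterministic) learning-augmented online algorithm for uniform speed scaling. It is given
`D`, `T` and the prediction in advance, always outputs a feasible schedule of the actual workload,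
and its speeds at time `t` depend only on the actual workloads released up to time `t`. -/
structure OnlineAlgorithm where
  run : (D T : ℕ) → (pred real : Workload D T) → Schedule D T
  feasible : ∀ D T : ℕ, 0 < D → D ≤ T → ∀ pred real : Workload D T,
    Feasible real (run D T pred real)
  online : ∀ D T : ℕ, 0 < D → D ≤ T → ∀ (pred real real' : Workload D T) (t : ℝ),
    (∀ j : Fin (T - D + 1), ((j : ℕ) : ℝ) ≤ t → real j = real' j) →
    ∀ i, run D T pred real i t = run D T pred real' i t

/-- For a fixed prediction, duration and horizon, the cost is monotone in the actual workload. -/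
def OnlineAlgorithm.IsMonotone (α : ℝ) (A : OnlineAlgorithm) : Prop :=
  ∀ D T : ℕ, 0 < D → D ≤ T → ∀ pred w w' : Workload D T, w' ≤ w →
    cost α (A.run D T pred w') ≤ cost α (A.run D T pred w)

/-- On all instances and predictions the cost is at most
`min {C · OPT + C' · err, C'' · OPT}`. -/
def OnlineAlgorithm.HasGuarantee (α : ℝ) (A : OnlineAlgorithm) (C C' C'' : ℝ≥0) : Prop :=
  ∀ D T : ℕ, 0 < D → D ≤ T → ∀ pred real : Workload D T,
    cost α (A.run D T pred real) ≤
      min ((C : ℝ≥0∞) * OPT α real + (C' : ℝ≥0∞) * err α real pred)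
        ((C'' : ℝ≥0∞) * OPT α real)

end SpeedScaling

/-!
The conversion works with `z = max η ζ`.

If `z` is at least `1 / 16`, the average rate schedule is used. It is `2 ^ α`-competitive
(`cost_averageRate_le`), and no algorithm is better than `OPT` even with a perfect prediction, so
the constants `C` and `C''` are at least `1` (`OnlineAlgorithm.HasGuarantee.one_le`).

If `z` is small, time is cut into blocks of length `B = ⌊z D⌋`; when `B = 0`, a neighbor of the
prediction is the prediction itself, and nothing has to be done. Work that is moved by at most `η D`
stays in its block or goes to an adjacent one. The actual work is matched online and
first-in-first-out to the blocks of the prediction, each of which has its capacity increased by the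
factor `1 + z`; work that would be left unmatched is distributed uniformly over a block. All of this
can be done with a delay of less than `4 B`, so a schedule of the moved work with windows of length
`D - 4 B` is a schedule of the actual work (`feasible_matchedSchedule`), and `A` is run on the moved
work with the increased prediction.

Two facts make this efficient. Firstly, shortening the windows is cheap: a schedule can be assumed
to process the jobs first-in-first-out (`Feasible.exists_fifo_times`), and then an affine change of
time, with a different offset for every job, shrinks all windows without making two jobs collide
(`Feasible.exists_shrink`, `OPT_le_of_delay`). Secondly, the work in excess of the capacities is
controlled by the error. The lag of the online matching behind an offline matching to a neighbor
`w` of the prediction is at most the capacity of two blocks up to errors, hence the extra capacity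
reduces the lag by a factor `1 + z` every other block (`lag_recurrence`), and the excess is bounded
by `32 / z` times the error in the `α`-norm (`sum_excess_rpow_le`). Monotonicity of `A` allows
replacing the moved work by its upper bound, the increased prediction plus the excess, which differs
from the prediction given to `A` by the excess only (`cost_matchedSchedule_le`).
-/

namespace SpeedScaling

open MeasureTheory Set

/-! ### Schedules and the optimal cost -/

variable {D T : ℕ}

lemma Feasible.of_lintegral {w : Workload D T} {s : Schedule D T} (hm : ∀ i, Measurable (s i))
    (hs : ∀ i t, s i t ≠ 0 → t ∈ Icc ((i : ℕ) : ℝ) (((i : ℕ) : ℝ) + D))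
    (hint : ∀ i, ∫⁻ t, (s i t : ℝ≥0∞) = w i) : Feasible w s := by
  refine fun i ↦ ⟨hm i, fun t ht ↦ by_contra fun h ↦ ht (hs i t h), ?_⟩
  rw [← hint i]
  exact setLIntegral_eq_of_support_subset fun t ht ↦ hs i t (by simpa using ht)

lemma Feasible.measurable {w : Workload D T} {s : Schedule D T} (h : Feasible w s) (i) :
    Measurable (s i) := (h i).1

lemma Feasible.mem_Icc {w : Workload D T} {s : Schedule D T} (h : Feasible w s) {i} {t : ℝ}
    (ht : s i t ≠ 0) : t ∈ Icc ((i : ℕ) : ℝ) (((i : ℕ) : ℝ) + D) :=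
  by_contra fun h' ↦ ht ((h i).2.1 t h')

lemma Feasible.lintegral {w : Workload D T} {s : Schedule D T} (h : Feasible w s) (i) :
    ∫⁻ t, (s i t : ℝ≥0∞) = w i := by
  rw [← (h i).2.2]
  exact (setLIntegral_eq_of_support_subset fun t ht ↦ h.mem_Icc (by simpa using ht)).symm

lemma cost_le_lintegral (α : ℝ) (s : Schedule D T) :
    cost α s ≤ ∫⁻ t, (∑ i, (s i t : ℝ≥0∞)) ^ α :=
  setLIntegral_le_lintegral _ _

lemma Feasible.cost_eq {α : ℝ} (hα : 0 < α) (hDT : D ≤ T) {w : Workload D T} {s : Schedule D T}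
    (h : Feasible w s) : cost α s = ∫⁻ t, (∑ i, (s i t : ℝ≥0∞)) ^ α := by
  refine setLIntegral_eq_of_support_subset fun t ht ↦ ?_
  have : ∃ i, s i t ≠ 0 := by
    by_contra! h0
    exact ht (by simp [h0, hα])
  obtain ⟨i, hi⟩ := this
  have h1 := h.mem_Icc hi
  have h2 : ((i : ℕ) : ℝ) + D ≤ T := by
    have := i.2
    exact_mod_cast (by omega : (i : ℕ) + D ≤ T)
  exact ⟨le_trans (by positivity) h1.1, h1.2.trans h2⟩

lemma OPT_le_cost (α : ℝ) {w : Workload D T} {s : Schedule D T} (h : Feasible w s) :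
    OPT α w ≤ cost α s := iInf₂_le s h

/-- A bound that is affine in the cost of every feasible schedule is a bound in terms of `OPT`. -/
lemma le_mul_OPT_add {α : ℝ} {w : Workload D T} {x a b : ℝ≥0∞} (ha : a ≠ 0) (ha' : a ≠ ∞)
    (h : ∀ s, Feasible w s → x ≤ a * cost α s + b) : x ≤ a * OPT α w + b := by
  rw [OPT, ENNReal.mul_iInf_of_ne ha ha', ENNReal.iInf_add]
  refine le_iInf fun s ↦ ?_
  rw [ENNReal.mul_iInf_of_ne ha ha', ENNReal.iInf_add]
  exact le_iInf (h s)

/-- Distributing the work of the jobs `i` of one instance over the jobs `m` of another one: job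
`m` takes over the fraction `y i m / w i` of the speed at which job `i` is processed. -/
noncomputable def resplit {D' T' : ℕ} (w : Workload D T)
    (y : Fin (T - D + 1) → Fin (T' - D' + 1) → ℝ≥0) (s : Schedule D T) : Schedule D' T' :=
  fun m t ↦ ∑ i, y i m / w i * s i t

/-- Job `m` may take over work of job `i` if job `i` is only processed in the window of job `m`. -/
lemma feasible_resplit {D' T' : ℕ} {w : Workload D T} {w' : Workload D' T'}
    {y : Fin (T - D + 1) → Fin (T' - D' + 1) → ℝ≥0} {s : Schedule D T}
    (hm : ∀ i, Measurable (s i)) (hint : ∀ i, ∫⁻ t, (s i t : ℝ≥0∞) = w i)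
    (hy : ∀ i, ∑ m, y i m ≤ w i) (hy' : ∀ m, ∑ i, y i m = w' m)
    (hs : ∀ i m t, y i m ≠ 0 → s i t ≠ 0 → t ∈ Icc ((m : ℕ) : ℝ) (((m : ℕ) : ℝ) + D')) :
    Feasible w' (resplit w y s) := by
  refine .of_lintegral (fun m ↦ ?_) (fun m t ht ↦ ?_) fun m ↦ ?_
  · exact Finset.measurable_sum _ fun i _ ↦ (hm i).const_mul _
  · obtain ⟨i, -, hi⟩ := Finset.exists_ne_zero_of_sum_ne_zero ht
    refine hs i m t ?_ ?_ <;> rintro h0 <;> simp [h0] at hi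
  · simp only [resplit, ENNReal.ofNNReal_finsetSum, ENNReal.coe_mul]
    rw [lintegral_finsetSum _ fun i _ ↦ ((hm i).coe_nnreal_ennreal.const_mul _)]
    rw [← hy' m, ENNReal.ofNNReal_finsetSum]
    refine Finset.sum_congr rfl fun i _ ↦ ?_
    rw [lintegral_const_mul _ (hm i).coe_nnreal_ennreal, hint, ← ENNReal.coe_mul]
    rcases eq_or_ne (w i) 0 with h0 | h0
    · have := (Finset.single_le_sum (f := y i) (fun _ _ ↦ zero_le) (Finset.mem_univ m)).trans (hy i)
      simp_all
    · rw [div_mul_cancel₀ _ h0]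

lemma sum_resplit_le {D' T' : ℕ} {w : Workload D T}
    {y : Fin (T - D + 1) → Fin (T' - D' + 1) → ℝ≥0} (s : Schedule D T)
    (hy : ∀ i, ∑ m, y i m ≤ w i) (t : ℝ) :
    ∑ m, (resplit w y s m t : ℝ≥0∞) ≤ ∑ i, (s i t : ℝ≥0∞) := by
  norm_cast
  simp only [resplit]
  rw [Finset.sum_comm]
  refine Finset.sum_le_sum fun i _ ↦ ?_
  rw [← Finset.sum_mul, ← Finset.sum_div]
  exact mul_le_of_le_one_left zero_le (div_le_one_of_le₀ (hy i) zero_le)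

lemma cost_resplit_le {α : ℝ} (hα : 0 ≤ α) {D' T' : ℕ} {w : Workload D T}
    {y : Fin (T - D + 1) → Fin (T' - D' + 1) → ℝ≥0} (s : Schedule D T)
    (hy : ∀ i, ∑ m, y i m ≤ w i) :
    cost α (resplit w y s) ≤ ∫⁻ t, (∑ i, (s i t : ℝ≥0∞)) ^ α :=
  (cost_le_lintegral _ _).trans <|
    lintegral_mono fun t ↦ ENNReal.rpow_le_rpow (sum_resplit_le s hy t) hα

lemma OPT_mono {α : ℝ} (hα : 0 < α) (hDT : D ≤ T) {w w' : Workload D T} (h : w ≤ w') :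
    OPT α w ≤ OPT α w' := by
  refine le_iInf₂ fun s hs ↦ ?_
  set y : Fin (T - D + 1) → Fin (T - D + 1) → ℝ≥0 := fun i m ↦ if i = m then w i else 0 with hy
  have h1 : ∀ i, ∑ m, y i m ≤ w' i := fun i ↦ by simpa [hy] using h i
  have h2 : Feasible w (resplit w' y s) := by
    refine feasible_resplit hs.measurable hs.lintegral h1 (fun m ↦ by simp [hy]) ?_
    intro i m t hy0 ht
    obtain rfl : i = m := by by_contra h0; simp [hy, h0] at hy0
    exact hs.mem_Icc ht
  rw [hs.cost_eq hα hDT]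
  exact (OPT_le_cost α h2).trans (cost_resplit_le hα.le s h1)

lemma OPT_const_mul_le {α : ℝ} (hα : 0 < α) {c : ℝ≥0} (hc : c ≠ 0) (w : Workload D T) :
    OPT α (fun i ↦ c * w i) ≤ (c : ℝ≥0∞) ^ α * OPT α w := by
  have key : ∀ s, Feasible w s → OPT α (fun i ↦ c * w i) ≤ (c : ℝ≥0∞) ^ α * cost α s + 0 := by
    intro s hs
    have hf : Feasible (fun i ↦ c * w i) (fun i t ↦ c * s i t : Schedule D T) := by
      refine .of_lintegral (fun i ↦ (hs.measurable i).const_mul _) (fun i t ht ↦ ?_) fun i ↦ ?_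
      · exact hs.mem_Icc (right_ne_zero_of_mul ht)
      · simp only [ENNReal.coe_mul]
        rw [lintegral_const_mul _ (hs.measurable i).coe_nnreal_ennreal, hs.lintegral]
    refine (OPT_le_cost α hf).trans_eq ?_
    simp only [cost, ENNReal.coe_mul, ← Finset.mul_sum, ENNReal.mul_rpow_of_nonneg _ _ hα.le,
      add_zero]
    exact lintegral_const_mul' _ _ (by simp [hα.le])
  simpa using le_mul_OPT_add (by simp [hα, hc]) (by simp [hα.le]) key

/-- Either `b ≤ z a` or `a ≤ b / z`. -/
lemma add_rpow_le_of_pos {α : ℝ} (hα : 0 ≤ α) {z : ℝ≥0} (hz : z ≠ 0) (a b : ℝ≥0∞) :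
    (a + b) ^ α ≤ (1 + z : ℝ≥0∞) ^ α * a ^ α + (1 + (z : ℝ≥0∞)⁻¹) ^ α * b ^ α := by
  rw [← ENNReal.mul_rpow_of_nonneg _ _ hα, ← ENNReal.mul_rpow_of_nonneg _ _ hα]
  rcases le_total b (z * a) with h | h
  · refine le_add_right (ENNReal.rpow_le_rpow ?_ hα)
    rw [add_mul, one_mul]
    gcongr
  · refine le_add_left (ENNReal.rpow_le_rpow ?_ hα)
    rw [add_mul, one_mul, add_comm]
    gcongr
    rwa [mul_comm, ← div_eq_mul_inv, ENNReal.le_div_iff_mul_le (by simp [hz]) (by simp), mul_comm]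

lemma OPT_add_le {α : ℝ} (hα : 0 < α) {z : ℝ≥0} (hz : z ≠ 0) (u v : Workload D T) :
    OPT α (u + v) ≤
      (1 + z : ℝ≥0∞) ^ α * OPT α u + (1 + (z : ℝ≥0∞)⁻¹) ^ α * OPT α v := by
  refine le_mul_OPT_add (by simp [hα]) (by simp) fun s hs ↦ ?_
  rw [add_comm (_ * cost α s)]
  refine le_mul_OPT_add (by simp [hα, hα.le]) (by simp [hz]) fun s' hs' ↦ ?_
  have hf : Feasible (u + v) (fun i t ↦ s i t + s' i t : Schedule D T) := by
    refine .of_lintegral (fun i ↦ (hs.measurable i).add (hs'.measurable i)) (fun i t ht ↦ ?_)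
      fun i ↦ ?_
    · by_cases h : s i t = 0
      · exact hs'.mem_Icc (by simpa [h] using ht)
      · exact hs.mem_Icc h
    · simp only [ENNReal.coe_add, Pi.add_apply]
      rw [lintegral_add_left (hs.measurable i).coe_nnreal_ennreal, hs.lintegral, hs'.lintegral]
  refine (OPT_le_cost α hf).trans ?_
  rw [add_comm (_ * cost α s')]
  simp only [cost]
  rw [← lintegral_const_mul' _ _ (by simp),
    ← lintegral_const_mul' _ _ (by simp [hz]), ← lintegral_add_left]
  · refine lintegral_mono fun t ↦ ?_
    simp only [ENNReal.coe_add, Finset.sum_add_distrib]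
    exact add_rpow_le_of_pos hα.le hz _ _
  · exact ((Finset.measurable_sum _ fun i _ ↦ (hs.measurable i).coe_nnreal_ennreal).pow_const
      _).const_mul _

/-- Processing every job at constant speed during the first unit of time after its release shows
that `OPT` is at most the sum of the `α`-th powers of the workloads. -/
lemma OPT_le_sum_rpow {α : ℝ} (hα : 0 < α) (hD : 0 < D) (u : Workload D T) :
    OPT α u ≤ ∑ i, (u i : ℝ≥0∞) ^ α := by
  set s : Schedule D T := fun i ↦ (Ico ((i : ℕ) : ℝ) ((i : ℕ) + 1)).indicator fun _ ↦ u i with hs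
  have hcoe : ∀ i t, (s i t : ℝ≥0∞) =
      (Ico ((i : ℕ) : ℝ) ((i : ℕ) + 1)).indicator (fun _ ↦ (u i : ℝ≥0∞)) t := fun i t ↦ by
    simp only [hs, indicator]; split_ifs <;> simp
  have hsupp : ∀ i t, s i t ≠ 0 → t ∈ Ico ((i : ℕ) : ℝ) ((i : ℕ) + 1) := fun i t ht ↦
    mem_of_indicator_ne_zero ht
  have hf : Feasible u s := by
    refine .of_lintegral (fun i ↦ measurable_const.indicator measurableSet_Ico) (fun i t ht ↦ ?_)
      fun i ↦ ?_
    · have h1 := hsupp i t ht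
      have h2 : (1 : ℝ) ≤ D := by exact_mod_cast hD
      exact ⟨h1.1, by linarith [h1.2]⟩
    · simp only [hcoe]
      rw [lintegral_indicator measurableSet_Ico]
      simp
  refine (OPT_le_cost α hf).trans ((cost_le_lintegral _ _).trans ?_)
  calc ∫⁻ t, (∑ i, (s i t : ℝ≥0∞)) ^ α
      ≤ ∫⁻ t, ∑ i : Fin (T - D + 1),
          (Ico ((i : ℕ) : ℝ) ((i : ℕ) + 1)).indicator (fun _ ↦ (u i : ℝ≥0∞) ^ α) t := by
        refine lintegral_mono fun t ↦ ?_
        by_cases h : ∃ i, s i t ≠ 0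
        · obtain ⟨i, hi⟩ := h
          have h1 := hsupp i t hi
          have hu : ∀ j, j ≠ i → (s j t : ℝ≥0∞) = 0 := by
            intro j hj
            by_contra h0
            have h2 := hsupp j t (by simpa using h0)
            have h3 : ((i : ℕ) : ℝ) < (j : ℕ) + 1 := h1.1.trans_lt h2.2
            have h4 : ((j : ℕ) : ℝ) < (i : ℕ) + 1 := h2.1.trans_lt h1.2
            norm_cast at h3 h4
            exact hj (Fin.ext (by omega))
          rw [Finset.sum_eq_single i (fun j _ hj ↦ hu j hj) (by simp), hcoe]
          refine le_trans ?_ (Finset.single_le_sum (fun _ _ ↦ zero_le) (Finset.mem_univ i))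
          simp [h1]
        · push Not at h
          simp [h, hα]
    _ = ∑ i, (u i : ℝ≥0∞) ^ α := by
        rw [lintegral_finsetSum _ fun i _ ↦ measurable_const.indicator measurableSet_Ico]
        refine Finset.sum_congr rfl fun i _ ↦ ?_
        rw [lintegral_indicator measurableSet_Ico]
        simp

/-! ### First-in-first-out schedules and shrinking of windows -/

/-- The total of the first `n` terms of a sequence. -/
def cum (f : ℕ → ℝ≥0) (n : ℕ) : ℝ≥0 := ∑ i ∈ Finset.range n, f i

/-- A workload vector as a sequence, extended by zero. -/
def extend {D T : ℕ} (w : Workload D T) (n : ℕ) : ℝ≥0 :=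
  if h : n < T - D + 1 then w ⟨n, h⟩ else 0

lemma cum_mono (f : ℕ → ℝ≥0) : Monotone (cum f) := fun _ _ h ↦
  Finset.sum_le_sum_of_subset (Finset.range_mono h)

lemma cum_succ (f : ℕ → ℝ≥0) (n : ℕ) : cum f (n + 1) = cum f n + f n := Finset.sum_range_succ ..

@[simp] lemma extend_coe (w : Workload D T) (i : Fin (T - D + 1)) : extend w i = w i := by
  simp only [extend, i.2, dite_true, Fin.eta]

lemma extend_of_le (w : Workload D T) {n : ℕ} (h : T - D + 1 ≤ n) : extend w n = 0 :=
  dif_neg (not_lt.2 h)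

lemma cum_extend (w : Workload D T) (n : ℕ) :
    cum (extend w) n = ∑ i : Fin (T - D + 1), if (i : ℕ) < n then w i else 0 := by
  have h1 : ∑ i : Fin (T - D + 1), (if (i : ℕ) < n then w i else 0) =
      ∑ i ∈ Finset.range (T - D + 1), if i < n then extend w i else 0 := by
    rw [Finset.sum_range]
    simp
  rw [h1, ← Finset.sum_filter, cum]
  refine (Finset.sum_subset (fun i hi ↦ by simp_all) fun i hi hi' ↦ ?_).symm
  exact extend_of_le w (by simp_all)

/-- Work of jobs released at or after `n` is not processed before `n`, and work of jobs released
before `n` is finished at time `n - 1 + D`. -/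
lemma Feasible.lintegral_Iic {w : Workload D T} {s : Schedule D T} (h : Feasible w s) (n : ℕ) :
    (∫⁻ t in Iic (n : ℝ), ∑ i, (s i t : ℝ≥0∞)) ≤ cum (extend w) n ∧
    (cum (extend w) (n + 1) : ℝ≥0∞) ≤ ∫⁻ t in Iic ((n : ℝ) + D), ∑ i, (s i t : ℝ≥0∞) := by
  rw [lintegral_finsetSum _ fun i _ ↦ (h.measurable i).coe_nnreal_ennreal,
    lintegral_finsetSum _ fun i _ ↦ (h.measurable i).coe_nnreal_ennreal, cum_extend, cum_extend]
  simp only [ENNReal.ofNNReal_finsetSum]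
  refine ⟨Finset.sum_le_sum fun i _ ↦ ?_, Finset.sum_le_sum fun i _ ↦ ?_⟩
  · split_ifs with hi
    · exact (setLIntegral_le_lintegral _ _).trans_eq (h.lintegral i)
    · rw [← setLIntegral_congr Iio_ae_eq_Iic, setLIntegral_congr_fun (g := fun _ ↦ 0)
        measurableSet_Iio]
      · simp
      · intro t ht
        by_contra h0
        have h1 := (h.mem_Icc (i := i) (t := t) (by simpa using h0)).1
        have h2 : (n : ℝ) ≤ (i : ℕ) := by exact_mod_cast not_lt.1 hi
        simp only [mem_Iio] at ht
        linarith
  · split_ifs with hi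
    · rw [← (h i).2.2]
      refine lintegral_mono_set fun t ht ↦ ht.2.trans ?_
      have : ((i : ℕ) : ℝ) ≤ n := by exact_mod_cast Nat.lt_succ_iff.1 hi
      linarith
    · simp

/-- The cumulative speed of a feasible schedule is cut into consecutive time intervals
`(τ i, τ (i + 1)]` that carry exactly the workloads `w i`: processing the jobs first-in-first-out
in these intervals meets all release times and deadlines. -/
lemma Feasible.exists_fifo_times (hD : 0 < D) {w : Workload D T} {s : Schedule D T}
    (h : Feasible w s) :
    ∃ τ : ℕ → ℝ, Monotone τ ∧ (∀ n : ℕ, (n : ℝ) ≤ τ n) ∧ (∀ n : ℕ, τ (n + 1) ≤ (n : ℝ) + D) ∧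
      ∀ i : Fin (T - D + 1), ∫⁻ t in Ioc (τ i) (τ (i + 1)), ∑ j, (s j t : ℝ≥0∞) = w i := by
  set f : ℝ → ℝ := fun t ↦ ∑ j, (s j t : ℝ) with hf
  have hf0 : ∀ t, 0 ≤ f t := fun t ↦ Finset.sum_nonneg fun _ _ ↦ NNReal.coe_nonneg _
  have hfE : ∀ t, ∑ j, (s j t : ℝ≥0∞) = ENNReal.ofReal (f t) := fun t ↦ by
    rw [hf, ENNReal.ofReal_sum_of_nonneg fun _ _ ↦ NNReal.coe_nonneg _]
    simp
  have hfm : Measurable f := Finset.measurable_sum _ fun i _ ↦ (h.measurable i).coe_nnreal_real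
  have hfi : Integrable f := by
    refine ⟨hfm.aestronglyMeasurable, ?_⟩
    rw [hasFiniteIntegral_iff_ofReal (ae_of_all _ hf0)]
    simp only [← hfE]
    rw [lintegral_finsetSum _ fun i _ ↦ (h.measurable i).coe_nnreal_ennreal]
    simp [h.lintegral]
  set F : ℝ → ℝ := fun t ↦ ∫ x in Iic t, f x with hF
  have hFE : ∀ t, ENNReal.ofReal (F t) = ∫⁻ x in Iic t, ∑ j, (s j x : ℝ≥0∞) := fun t ↦ by
    simp only [hfE]
    exact ofReal_integral_eq_lintegral_ofReal hfi.integrableOn (ae_of_all _ hf0)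
  have hF0 : ∀ t, 0 ≤ F t := fun t ↦ integral_nonneg hf0
  have hsub : ∀ a b, F b - F a = ∫ x in a..b, f x := fun a b ↦
    intervalIntegral.integral_Iic_sub_Iic hfi.integrableOn hfi.integrableOn
  have hFc : Continuous F := by
    have h1 : F = fun t ↦ F 0 + ∫ x in (0 : ℝ)..t, f x := by
      ext t; rw [← hsub]; ring
    rw [h1]
    exact continuous_const.add
      (intervalIntegral.continuous_primitive (fun a b ↦ hfi.intervalIntegrable) 0)
  have hFm : Monotone F := fun a b hab ↦ by
    rw [← sub_nonneg, hsub]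
    exact intervalIntegral.integral_nonneg_of_forall hab hf0
  have hle : ∀ n : ℕ, F n ≤ cum (extend w) n := fun n ↦ by
    have := (h.lintegral_Iic n).1
    rw [← hFE] at this
    exact (ENNReal.ofReal_le_iff_le_toReal (by simp)).1 this
  have hge : ∀ n : ℕ, (cum (extend w) (n + 1) : ℝ) ≤ F ((n : ℝ) + D) := fun n ↦ by
    have := (h.lintegral_Iic n).2
    rw [← hFE, ENNReal.le_ofReal_iff_toReal_le (by simp) (hF0 _)] at this
    exact this
  have hD1 : (1 : ℝ) ≤ D := by exact_mod_cast hD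
  have hex : ∀ n : ℕ, ∃ t ∈ Icc ((n : ℝ) + 1) ((n : ℝ) + D), F t = cum (extend w) (n + 1) := by
    intro n
    have := intermediate_value_Icc (by linarith : (n : ℝ) + 1 ≤ (n : ℝ) + D) hFc.continuousOn
    exact this ⟨by exact_mod_cast hle (n + 1), hge n⟩
  choose σ hσ hσF using hex
  -- where `F` is constant the chosen times need not be ordered, hence the running maximum
  set τ₀ : ℕ → ℝ := fun n ↦ n.casesOn 0 σ with hτ₀
  have hτ : ∀ n : ℕ, (n : ℝ) ≤ partialSups τ₀ n ∧ partialSups τ₀ (n + 1) ≤ (n : ℝ) + D ∧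
      F (partialSups τ₀ n) = cum (extend w) n := by
    have step : ∀ n : ℕ, partialSups τ₀ (n + 1) = partialSups τ₀ n ⊔ σ n := fun n ↦
      partialSups_add_one _ _
    intro n
    induction n with
    | zero =>
      have h1 := (hσ 0).1
      have h2 := (hσ 0).2
      have h3 : F 0 = 0 := le_antisymm (by simpa [cum] using hle 0) (hF0 0)
      have h4 : partialSups τ₀ 0 = 0 := partialSups_zero τ₀
      rw [step, h4, h3]
      simp only [CharP.cast_eq_zero, zero_add] at *
      exact ⟨le_rfl, sup_le (by linarith) h2, by simp [cum]⟩
    | succ n ih =>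
      rw [step (n + 1)]
      refine ⟨?_, sup_le ?_ (hσ _).2, ?_⟩
      · rw [step]
        exact le_sup_of_le_right (by exact_mod_cast (hσ n).1)
      · exact ih.2.1.trans (by push_cast; linarith)
      · rw [step, hFm.map_sup, ih.2.2, hσF]
        exact sup_of_le_right (by exact_mod_cast cum_mono _ n.le_succ)
  refine ⟨partialSups τ₀, (partialSups τ₀).monotone, fun n ↦ (hτ n).1, fun n ↦ (hτ n).2.1,
    fun i ↦ ?_⟩
  simp only [hfE]
  rw [← ofReal_integral_eq_lintegral_ofReal hfi.integrableOn (ae_of_all _ hf0),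
    ← intervalIntegral.integral_of_le ((partialSups τ₀).monotone (Nat.le_succ _)), ← hsub,
    (hτ _).2.2, (hτ _).2.2, cum_succ]
  simp

/-- The windows can be shrunk by `a` on both sides: if the work of job `i`, done first-in-first-out,
is moved from time `t` to time `μ t + (1 - μ) i + a` with `μ = 1 - 2 a / D`, then no two jobs ever
collide, and the energy grows by the factor `μ ^ (1 - α)` only. -/
lemma Feasible.exists_shrink {α : ℝ} (hα : 1 < α) (hD : 0 < D) (hDT : D ≤ T) {w : Workload D T}
    {s : Schedule D T} (h : Feasible w s) {a : ℝ} (ha : 0 < a) (haD : 2 * a < D) :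
    ∃ σ : Schedule D T, (∀ i, Measurable (σ i)) ∧ (∀ i, ∫⁻ t, (σ i t : ℝ≥0∞) = w i) ∧
      (∀ i t, σ i t ≠ 0 → t ∈ Icc ((i : ℕ) + a) ((i : ℕ) + D - a)) ∧
      ∫⁻ t, (∑ i, (σ i t : ℝ≥0∞)) ^ α ≤
        ENNReal.ofReal ((1 - 2 * a / D)⁻¹ ^ (α - 1)) * cost α s := by
  obtain ⟨τ, hτm, hτ1, hτ2, hτw⟩ := h.exists_fifo_times hD
  have hD0 : (0 : ℝ) < D := by exact_mod_cast hD
  set μ : ℝ := 1 - 2 * a / D with hμ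
  have hμ0 : 0 < μ := by rw [hμ, sub_pos, div_lt_one hD0]; exact haD
  have hμ1 : μ < 1 := by rw [hμ]; linarith [div_pos (mul_pos two_pos ha) hD0]
  have hμD : μ * D = D - 2 * a := by rw [hμ]; field_simp
  set f : ℝ → ℝ≥0 := fun t ↦ ∑ j, s j t with hf
  have hfm : Measurable f := Finset.measurable_sum _ fun i _ ↦ h.measurable i
  have hfE : ∀ t, (f t : ℝ≥0∞) = ∑ j, (s j t : ℝ≥0∞) := fun t ↦ by
    simp [hf, ENNReal.ofNNReal_finsetSum]
  -- the inverse time change of job `i`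
  set φ : Fin (T - D + 1) → ℝ → ℝ := fun i t ↦ μ⁻¹ * (t + (-(1 - μ) * (i : ℕ) - a)) with hφ
  have hφm : ∀ i, Measurable (φ i) := fun i ↦ (measurable_id.add_const _).const_mul _
  have hφt : ∀ i t, μ * φ i t + (1 - μ) * (i : ℕ) + a = t := fun i t ↦ by
    simp only [hφ]; field_simp; ring
  set g : Fin (T - D + 1) → ℝ → ℝ≥0 := fun i ↦ (Ioc (τ i) (τ (i + 1))).indicator f with hg
  have hgm : ∀ i, Measurable (g i) := fun i ↦ hfm.indicator measurableSet_Ioc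
  have hgsupp : ∀ i t, g i t ≠ 0 → t ∈ Ioc (τ i) (τ (i + 1)) := fun i t ht ↦
    mem_of_indicator_ne_zero ht
  have hchange : ∀ i (k : ℝ → ℝ≥0∞), Measurable k →
      ∫⁻ t, k (φ i t) = ENNReal.ofReal μ * ∫⁻ t, k t := by
    intro i k hk
    have h1 := lintegral_add_right_eq_self (μ := (volume : Measure ℝ))
      (fun t ↦ k (μ⁻¹ * t)) (-(1 - μ) * (i : ℕ) - a)
    have h2 := lintegral_map (μ := volume) hk (measurable_const_mul μ⁻¹)
    rw [Real.map_volume_mul_left (inv_ne_zero hμ0.ne'), lintegral_smul_measure, inv_inv,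
      abs_of_pos hμ0] at h2
    simp only [hφ]
    rw [h1, ← h2, smul_eq_mul]
  set c : ℝ≥0 := μ⁻¹.toNNReal with hc
  have hcμ : (c : ℝ≥0∞) * ENNReal.ofReal μ = 1 := by
    rw [hc]
    change ENNReal.ofReal μ⁻¹ * ENNReal.ofReal μ = 1
    rw [← ENNReal.ofReal_mul (inv_pos.2 hμ0).le, inv_mul_cancel₀ hμ0.ne', ENNReal.ofReal_one]
  set σ : Schedule D T := fun i t ↦ c * g i (φ i t) with hσ
  have hσsupp : ∀ i t, σ i t ≠ 0 → φ i t ∈ Ioc (τ i) (τ (i + 1)) := fun i t ht ↦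
    hgsupp i _ (right_ne_zero_of_mul ht)
  -- the job with the larger index is processed later and has the larger offset
  have hdisj : ∀ i j t, i < j → σ i t ≠ 0 → σ j t = 0 := by
    intro i j t hij hi
    by_contra hj
    have h1 := (hσsupp i t hi).2
    have h2 := (hσsupp j t hj).1
    have h3 : τ (i + 1) ≤ τ j := hτm (by exact_mod_cast hij)
    have h4 : φ i t < φ j t := by linarith
    have h5 := hφt i t
    have h6 := hφt j t
    have h7 : ((i : ℕ) : ℝ) < (j : ℕ) := by exact_mod_cast hij
    nlinarith
  refine ⟨σ, fun i ↦ ((hgm i).comp (hφm i)).const_mul _, fun i ↦ ?_, fun i t ht ↦ ?_, ?_⟩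
  · simp only [hσ, ENNReal.coe_mul]
    rw [lintegral_const_mul' _ _ (by simp), hchange i (fun t ↦ g i t) (hgm i).coe_nnreal_ennreal,
      ← mul_assoc, hcμ, one_mul, ← hτw i, ← lintegral_indicator measurableSet_Ioc]
    refine lintegral_congr fun t ↦ ?_
    simp only [hg, indicator]
    split_ifs <;> simp [← hfE]
  · have h1 := hσsupp i t ht
    have h2 := hτ1 i
    have h3 := hτ2 i
    have h4 := hφt i t
    have h5 : μ * (i : ℕ) ≤ μ * φ i t := by gcongr; linarith [h1.1]
    have h6 : μ * φ i t ≤ μ * ((i : ℕ) + D) := by gcongr; linarith [h1.2]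
    constructor <;> nlinarith
  · have hα0 : 0 < α := by linarith
    have h1 : ∀ t, (∑ i, (σ i t : ℝ≥0∞)) ^ α ≤ ∑ i, (σ i t : ℝ≥0∞) ^ α := by
      intro t
      by_cases h0 : ∃ i, σ i t ≠ 0
      · obtain ⟨i, hi⟩ := h0
        rw [Finset.sum_eq_single i, ]
        · exact Finset.single_le_sum (f := fun i ↦ (σ i t : ℝ≥0∞) ^ α) (fun _ _ ↦ zero_le)
            (Finset.mem_univ i)
        · intro j _ hj
          rcases lt_or_gt_of_ne hj with hlt | hlt
          · by_contra h'
            exact hi (hdisj j i t hlt (by simpa using h'))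
          · simp [hdisj i j t hlt hi]
        · simp
      · push Not at h0
        simp [h0, hα0]
    have h2 : ∀ t, ∑ i, (g i t : ℝ≥0∞) ^ α ≤ (f t : ℝ≥0∞) ^ α := by
      intro t
      by_cases h0 : ∃ i, g i t ≠ 0
      · obtain ⟨i, hi⟩ := h0
        rw [Finset.sum_eq_single i]
        · gcongr
          exact indicator_le_self' (fun _ _ ↦ zero_le) t
        · intro j _ hj
          by_contra h'
          have h3 := hgsupp j t (by rintro h0; simp [h0, hα0] at h')
          have h4 := hgsupp i t hi
          rcases lt_or_gt_of_ne hj with hlt | hlt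
          · exact absurd (h3.2.trans (hτm (by exact_mod_cast hlt))) (not_le.2 h4.1)
          · exact absurd (h4.2.trans (hτm (by exact_mod_cast hlt))) (not_le.2 h3.1)
        · simp
      · push Not at h0
        simp [h0, hα0]
    calc ∫⁻ t, (∑ i, (σ i t : ℝ≥0∞)) ^ α
        ≤ ∫⁻ t, ∑ i, (σ i t : ℝ≥0∞) ^ α := lintegral_mono h1
      _ = ∑ i, ∫⁻ t, (σ i t : ℝ≥0∞) ^ α := lintegral_finsetSum _ fun i _ ↦
          (((hgm i).comp (hφm i)).const_mul _).coe_nnreal_ennreal.pow_const _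
      _ = ∑ i, (c : ℝ≥0∞) ^ α * (ENNReal.ofReal μ * ∫⁻ t, (g i t : ℝ≥0∞) ^ α) := by
          refine Finset.sum_congr rfl fun i _ ↦ ?_
          rw [← hchange i (fun t ↦ (g i t : ℝ≥0∞) ^ α)
            ((hgm i).coe_nnreal_ennreal.pow_const _), ← lintegral_const_mul' _ _
            (by simp [hα0.le])]
          refine lintegral_congr fun t ↦ ?_
          rw [← ENNReal.mul_rpow_of_nonneg _ _ hα0.le]
          simp [hσ]
      _ = (c : ℝ≥0∞) ^ α * ENNReal.ofReal μ * ∫⁻ t, ∑ i, (g i t : ℝ≥0∞) ^ α := by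
          rw [lintegral_finsetSum _ fun i _ ↦ (hgm i).coe_nnreal_ennreal.pow_const _,
            Finset.mul_sum]
          simp only [mul_assoc]
      _ ≤ (c : ℝ≥0∞) ^ α * ENNReal.ofReal μ * cost α s := by
          gcongr
          rw [h.cost_eq hα0 hDT]
          refine lintegral_mono fun t ↦ ?_
          rw [← hfE]
          exact h2 t
      _ = _ := by
          congr 1
          have hcpos : 0 < μ⁻¹ := inv_pos.2 hμ0
          have : (c : ℝ≥0∞) = ENNReal.ofReal μ⁻¹ := rfl
          rw [this, ENNReal.ofReal_rpow_of_pos hcpos,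
            ← ENNReal.ofReal_mul (Real.rpow_nonneg hcpos.le _), Real.rpow_sub_one hcpos.ne',
            div_inv_eq_mul]

/-- If the jobs of an instance are delayed by at most `4 B` and their duration is shortened by
`4 B`, then the optimal cost grows by the factor `(1 - 8 B / D) ^ (1 - α)` at most. -/
lemma OPT_le_of_delay {α : ℝ} (hα : 1 < α) (hD : 0 < D) (hDT : D ≤ T) {B : ℕ} (hB : 0 < B)
    (hBD : 8 * B < D) {w : Workload D T} {w' : Workload (D - 4 * B) T}
    (y : Fin (T - D + 1) → Fin (T - (D - 4 * B) + 1) → ℝ≥0)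
    (hy : ∀ i, ∑ m, y i m = w i) (hy' : ∀ m, ∑ i, y i m = w' m)
    (hsupp : ∀ i m, y i m ≠ 0 → (i : ℕ) ≤ m ∧ (m : ℕ) ≤ i + 4 * B) :
    OPT α w' ≤ ENNReal.ofReal ((1 - 8 * B / D : ℝ)⁻¹ ^ (α - 1)) * OPT α w := by
  have hD0 : (0 : ℝ) < D := by exact_mod_cast hD
  have hB0 : (0 : ℝ) < B := by exact_mod_cast hB
  have hBD' : (8 * B : ℝ) < D := by exact_mod_cast hBD
  have hpos : 0 < (1 - 8 * B / D : ℝ)⁻¹ ^ (α - 1) := by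
    refine Real.rpow_pos_of_pos (inv_pos.2 ?_) _
    rw [sub_pos, div_lt_one hD0]
    exact hBD'
  have key : ∀ s, Feasible w s →
      OPT α w' ≤ ENNReal.ofReal ((1 - 8 * B / D : ℝ)⁻¹ ^ (α - 1)) * cost α s + 0 := by
    intro s hs
    obtain ⟨σ, h1, h2, h3, h4⟩ := hs.exists_shrink hα hD hDT (a := 4 * B) (by positivity)
      (by linarith)
    have hf : Feasible w' (resplit w y σ) := by
      refine feasible_resplit h1 h2 (fun i ↦ (hy i).le) hy' fun i m t hne ht ↦ ?_
      have h5 := hsupp i m hne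
      have h6 := h3 i t ht
      have h7 : ((i : ℕ) : ℝ) ≤ (m : ℕ) := by exact_mod_cast h5.1
      have h8 : ((m : ℕ) : ℝ) ≤ (i : ℕ) + 4 * B := by exact_mod_cast h5.2
      have h9 : ((D - 4 * B : ℕ) : ℝ) = D - 4 * B := by
        rw [Nat.cast_sub (by omega)]; push_cast; ring
      rw [h9]
      exact ⟨by linarith [h6.1], by linarith [h6.2]⟩
    rw [add_zero]
    refine (OPT_le_cost α hf).trans ((cost_resplit_le (by linarith) σ fun i ↦ (hy i).le).trans ?_)
    rwa [show (8 * B / D : ℝ) = 2 * (4 * B) / D by ring]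
  simpa using le_mul_OPT_add (by simpa using hpos) (by simp) key

/-! ### The average rate schedule -/

/-- Jensen's inequality for the average of a function over an interval. -/
lemma rpow_lintegral_Icc_le {α : ℝ} (hα : 1 < α) {f : ℝ → ℝ≥0∞} (hf : Measurable f) (a b : ℝ) :
    (∫⁻ t in Icc a b, f t) ^ α ≤
      ENNReal.ofReal (b - a) ^ (α - 1) * ∫⁻ t in Icc a b, f t ^ α := by
  have hα0 : 0 < α := by linarith
  have hpq : α.HolderConjugate (α.conjExponent) := .conjExponent hα
  have h := ENNReal.lintegral_mul_le_Lp_mul_Lq (volume.restrict (Icc a b)) hpq hf.aemeasurable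
    (aemeasurable_const (b := (1 : ℝ≥0∞)))
  simp only [Pi.mul_apply, mul_one, ENNReal.one_rpow, lintegral_const, one_mul,
    Measure.restrict_apply_univ, Real.volume_Icc] at h
  calc (∫⁻ t in Icc a b, f t) ^ α
      ≤ ((∫⁻ t in Icc a b, f t ^ α) ^ (1 / α) *
          ENNReal.ofReal (b - a) ^ (1 / α.conjExponent)) ^ α := by gcongr
    _ = _ := by
        rw [ENNReal.mul_rpow_of_nonneg _ _ hα0.le, ← ENNReal.rpow_mul, ← ENNReal.rpow_mul,
          one_div_mul_cancel hα0.ne', ENNReal.rpow_one, mul_comm]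
        congr 2
        have : α - 1 ≠ 0 := by linarith
        rw [Real.conjExponent]
        field_simp

/-- The average rate schedule: every job is processed at constant speed during its window. The
half-open window makes the speed at the deadline zero, which does not affect the cost. -/
noncomputable def averageRate (w : Workload D T) : Schedule D T :=
  fun i ↦ (Ico ((i : ℕ) : ℝ) ((i : ℕ) + D)).indicator fun _ ↦ w i / D

lemma averageRate_feasible (hD : 0 < D) (w : Workload D T) : Feasible w (averageRate w) := by
  refine .of_lintegral (fun i ↦ measurable_const.indicator measurableSet_Ico) (fun i t ht ↦ ?_)
    fun i ↦ ?_
  · exact Ico_subset_Icc_self (mem_of_indicator_ne_zero ht)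
  · have hcoe : ∀ t, (averageRate w i t : ℝ≥0∞) =
        (Ico ((i : ℕ) : ℝ) ((i : ℕ) + D)).indicator (fun _ ↦ ((w i / D : ℝ≥0) : ℝ≥0∞)) t := by
      intro t
      simp only [averageRate, indicator]; split_ifs <;> simp
    simp only [hcoe]
    rw [lintegral_indicator measurableSet_Ico]
    simp only [lintegral_const, Measure.restrict_apply_univ, Real.volume_Ico, add_sub_cancel_left,
      ENNReal.ofReal_natCast]
    have : (D : ℝ≥0) ≠ 0 := by exact_mod_cast hD.ne'
    rw [← ENNReal.coe_natCast, ← ENNReal.coe_mul, div_mul_cancel₀ _ this]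

/-- The total speed at time `t` of the average rate schedule is at most twice the average speed in
`[t - D, t + D]` of any other schedule, because all jobs that are active at `t` have their windows
in there. -/
lemma sum_averageRate_le {w : Workload D T} {s : Schedule D T} (h : Feasible w s) (t : ℝ) :
    ∑ i, (averageRate w i t : ℝ≥0∞) ≤
      (D : ℝ≥0∞)⁻¹ * ∫⁻ x in Icc (t - D) (t + D), ∑ i, (s i x : ℝ≥0∞) := by
  rw [lintegral_finsetSum _ fun i _ ↦ (h.measurable i).coe_nnreal_ennreal, Finset.mul_sum]
  refine Finset.sum_le_sum fun i _ ↦ ?_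
  by_cases ht : t ∈ Ico ((i : ℕ) : ℝ) ((i : ℕ) + D)
  · have hD : 0 < D := by
      have : (0 : ℝ) < D := by linarith [ht.1, ht.2]
      exact_mod_cast this
    have h0 : (D : ℝ≥0) ≠ 0 := by exact_mod_cast hD.ne'
    rw [averageRate, indicator_of_mem ht, ENNReal.coe_div h0, div_eq_mul_inv, mul_comm,
      ENNReal.coe_natCast]
    gcongr
    rw [← (h i).2.2]
    exact lintegral_mono_set (Icc_subset_Icc (by linarith [ht.2]) (by linarith [ht.1]))
  · simp [averageRate, ht]

/-- The average rate schedule is `2 ^ α`-competitive. -/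
lemma cost_averageRate_le {α : ℝ} (hα : 1 < α) (hD : 0 < D) (hDT : D ≤ T) (w : Workload D T) :
    cost α (averageRate w) ≤ 2 ^ α * OPT α w := by
  have hα0 : 0 < α := by linarith
  have key : ∀ s, Feasible w s → cost α (averageRate w) ≤ 2 ^ α * cost α s + 0 := by
    intro s hs
    rw [hs.cost_eq hα0 hDT, add_zero]
    refine (cost_le_lintegral _ _).trans ?_
    set f : ℝ → ℝ≥0∞ := fun t ↦ ∑ i, (s i t : ℝ≥0∞) with hf
    have hfm : Measurable f :=
      Finset.measurable_sum _ fun i _ ↦ (hs.measurable i).coe_nnreal_ennreal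
    have hfmα : Measurable fun t ↦ f t ^ α := hfm.pow_const α
    have hD0 : (D : ℝ≥0∞) ≠ 0 := by exact_mod_cast hD.ne'
    have h2D : ENNReal.ofReal (2 * D) = 2 * D := by
      rw [ENNReal.ofReal_mul zero_le_two, ENNReal.ofReal_natCast, ENNReal.ofReal_ofNat]
    have hshift : ∀ t : ℝ, ∫⁻ x in Icc (t - D) (t + D), f x ^ α =
        ∫⁻ u in Icc (-(D : ℝ)) D, f (u + t) ^ α := by
      intro t
      rw [← lintegral_indicator measurableSet_Icc, ← lintegral_indicator measurableSet_Icc,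
        ← lintegral_add_right_eq_self _ t]
      refine lintegral_congr fun u ↦ ?_
      simp only [indicator, mem_Icc]
      congr 1
      exact propext ⟨fun h ↦ ⟨by linarith [h.1], by linarith [h.2]⟩,
        fun h ↦ ⟨by linarith [h.1], by linarith [h.2]⟩⟩
    calc ∫⁻ t, (∑ i, (averageRate w i t : ℝ≥0∞)) ^ α
        ≤ ∫⁻ t, (D : ℝ≥0∞)⁻¹ ^ α * ((2 * D : ℝ≥0∞) ^ (α - 1) *
            ∫⁻ u in Icc (-(D : ℝ)) D, f (u + t) ^ α) := by
          refine lintegral_mono fun t ↦ ?_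
          refine (ENNReal.rpow_le_rpow (sum_averageRate_le hs t) hα0.le).trans ?_
          rw [ENNReal.mul_rpow_of_nonneg _ _ hα0.le, ← hshift]
          gcongr
          refine (rpow_lintegral_Icc_le hα hfm _ _).trans_eq ?_
          rw [show t + D - (t - D) = 2 * (D : ℝ) by ring, h2D]
      _ = (D : ℝ≥0∞)⁻¹ ^ α * ((2 * D : ℝ≥0∞) ^ (α - 1) *
            ∫⁻ u in Icc (-(D : ℝ)) D, ∫⁻ t, f (u + t) ^ α) := by
          have hm : Measurable (Function.uncurry fun t u : ℝ ↦ f (u + t) ^ α) :=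
            hfmα.comp (measurable_snd.add measurable_fst)
          rw [lintegral_const_mul', lintegral_const_mul', lintegral_lintegral_swap]
          · exact hm.aemeasurable
          · exact ENNReal.rpow_ne_top_of_nonneg (by linarith)
              (ENNReal.mul_ne_top (by simp) (by simp))
          · exact ENNReal.rpow_ne_top_of_nonneg hα0.le (by simp [hD.ne'])
      _ = (D : ℝ≥0∞)⁻¹ ^ α * ((2 * D : ℝ≥0∞) ^ (α - 1) * ((∫⁻ t, f t ^ α) * (2 * D))) := by
          simp only [lintegral_add_left_eq_self (fun t ↦ f t ^ α), lintegral_const,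
            Measure.restrict_apply_univ, Real.volume_Icc]
          rw [show (D : ℝ) - -D = 2 * D by ring, h2D]
      _ = ((D : ℝ≥0∞)⁻¹ ^ α * ((2 * D : ℝ≥0∞) ^ (α - 1) * (2 * D) ^ (1 : ℝ))) *
            ∫⁻ t, f t ^ α := by
          rw [ENNReal.rpow_one]; ring
      _ = 2 ^ α * ∫⁻ t, f t ^ α := by
          have h2D0 : (2 * D : ℝ≥0∞) ≠ 0 := mul_ne_zero (by simp) hD0
          rw [← ENNReal.rpow_add _ _ h2D0 (ENNReal.mul_ne_top (by simp) (by simp)),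
            sub_add_cancel, ← ENNReal.mul_rpow_of_nonneg _ _ hα0.le, mul_comm (2 : ℝ≥0∞),
            ← mul_assoc, ENNReal.inv_mul_cancel hD0 (by simp), one_mul]
  have h2 : (2 : ℝ≥0∞) ^ α ≠ 0 := by simp [hα0]
  simpa using le_mul_OPT_add h2 (by simp) key

/-- The online algorithm that ignores the prediction and runs the average rate schedule. -/
noncomputable def averageRateAlgorithm : OnlineAlgorithm where
  run _ _ _ real := averageRate real
  feasible _ _ hD _ _ real := averageRate_feasible hD real
  online D T _ _ _ real real' t h i := by
    by_cases ht : t ∈ Ico ((i : ℕ) : ℝ) ((i : ℕ) + D)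
    · simp [averageRate, h i ht.1]
    · simp [averageRate, ht]

lemma err_self {α : ℝ} (hα : 0 < α) (w : Workload D T) : err α w w = 0 := by
  simp [err, Real.zero_rpow hα.ne']

/-- With a perfect prediction no guarantee can beat `OPT`, which is `1` for the instance with a
single unit job of unit duration. -/
lemma OnlineAlgorithm.HasGuarantee.one_le {α : ℝ} (hα : 1 < α) {A : OnlineAlgorithm}
    {C C' C'' : ℝ≥0} (h : A.HasGuarantee α C C' C'') : 1 ≤ C ∧ 1 ≤ C'' := by
  have hα0 : 0 < α := by linarith
  set w : Workload 1 1 := fun _ ↦ 1 with hw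
  have h1 : OPT α w ≤ 1 := by simpa [hw] using OPT_le_sum_rpow hα0 one_pos w
  have h2 : 1 ≤ OPT α w := by
    refine le_iInf₂ fun s hs ↦ ?_
    have hm : Measurable fun t ↦ (s 0 t : ℝ≥0∞) := (hs.measurable 0).coe_nnreal_ennreal
    have h3 := rpow_lintegral_Icc_le hα hm 0 1
    have h4 := (hs 0).2.2
    simp only [Fin.val_zero, CharP.cast_eq_zero, Nat.cast_one, zero_add] at h4
    rw [h4] at h3
    simpa [hw, cost] using h3
  have h5 : OPT α w = 1 := le_antisymm h1 h2
  have h6 := (OPT_le_cost α (A.feasible 1 1 one_pos le_rfl w w)).trans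
    (h 1 1 one_pos le_rfl w w)
  rw [err_self hα0, h5] at h6
  simpa using h6

/-! ### Matching work to a prediction -/

/-- The total of the `b`-th block of `B` consecutive terms of a sequence. -/
def blockSum (f : ℕ → ℝ≥0) (B b : ℕ) : ℝ≥0 := ∑ l ∈ Finset.range B, f (b * B + l)

lemma cum_add_blockSum (f : ℕ → ℝ≥0) (B b : ℕ) :
    cum f ((b + 1) * B) = cum f (b * B) + blockSum f B b := by
  rw [cum, cum, blockSum, add_mul, one_mul, Finset.sum_range_add]

lemma cum_mul (f : ℕ → ℝ≥0) (B K : ℕ) : cum f (K * B) = ∑ b ∈ Finset.range K, blockSum f B b := by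
  induction K with
  | zero => simp [cum]
  | succ K ih => rw [cum_add_blockSum, ih, Finset.sum_range_succ]

/-- The work is matched first-in-first-out to the prediction: `front z B p r b` is the amount of
actual work (in the order of release) that has been matched to the blocks before `b` of the
prediction. Block `b` of the prediction takes at most `1 + z` times its own total. It only takes
work of the blocks up to `b + 1`, and whatever is left of the blocks up to `b - 1` is matched to
it regardless of its capacity. -/
noncomputable def front (z : ℝ≥0) (B : ℕ) (p r : ℕ → ℝ≥0) : ℕ → ℝ≥0
  | 0 => 0
  | b + 1 => max (min (front z B p r b + (1 + z) * blockSum p B b) (cum r ((b + 2) * B)))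
      (cum r (b * B))

/-- The amount of work matched to block `b` of the prediction. -/
noncomputable def batch (z : ℝ≥0) (B : ℕ) (p r : ℕ → ℝ≥0) (b : ℕ) : ℝ≥0 :=
  front z B p r (b + 1) - front z B p r b

/-- The part of the work matched to block `b` that exceeds the capacity of the block. -/
noncomputable def excess (z : ℝ≥0) (B : ℕ) (p r : ℕ → ℝ≥0) (b : ℕ) : ℝ≥0 :=
  batch z B p r b - (1 + z) * blockSum p B b

/-- The work matched to a block is placed on its slots: the part within the capacity in proportion
to the prediction, the excess uniformly. -/
noncomputable def place (z : ℝ≥0) (B : ℕ) (p r : ℕ → ℝ≥0) (j : ℕ) : ℝ≥0 :=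
  min (batch z B p r (j / B)) ((1 + z) * blockSum p B (j / B)) * (p j / blockSum p B (j / B)) +
    excess z B p r (j / B) / B

/-- The amount of the work released at `i` that is matched to block `b`: work is identified with
the interval `[0, ∑ i, r i]`, in which job `i` and block `b` own an interval each. -/
noncomputable def overlap (z : ℝ≥0) (B : ℕ) (p r : ℕ → ℝ≥0) (i b : ℕ) : ℝ≥0 :=
  min (cum r (i + 1)) (front z B p r (b + 1)) - max (cum r i) (front z B p r b)

/-- The amount of the work released at `i` that is placed on slot `j`. -/
noncomputable def flow (z : ℝ≥0) (B : ℕ) (p r : ℕ → ℝ≥0) (i j : ℕ) : ℝ≥0 :=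
  overlap z B p r i (j / B) * (place z B p r j / batch z B p r (j / B))

section Flow

variable (z : ℝ≥0) (B : ℕ) (p r : ℕ → ℝ≥0)

lemma cum_le_front_succ (b : ℕ) : cum r (b * B) ≤ front z B p r (b + 1) := le_max_right _ _

lemma front_le_cum (b : ℕ) : front z B p r b ≤ cum r ((b + 1) * B) := by
  cases b with
  | zero => exact zero_le
  | succ b => exact max_le (min_le_right _ _) (cum_mono _ (by gcongr; omega))

lemma front_mono : Monotone (front z B p r) :=
  monotone_nat_of_le_succ fun b ↦
    le_max_of_le_left (le_min le_self_add ((front_le_cum z B p r b).trans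
      (cum_mono _ (by gcongr; omega))))

variable {B}

lemma sum_place (hB : 0 < B) (b : ℕ) : blockSum (place z B p r) B b = batch z B p r b := by
  have h0 : (B : ℝ≥0) ≠ 0 := by exact_mod_cast hB.ne'
  have h1 : ∀ l ∈ Finset.range B, place z B p r (b * B + l) =
      min (batch z B p r b) ((1 + z) * blockSum p B b) * (p (b * B + l) / blockSum p B b) +
        excess z B p r b / B := by
    intro l hl
    have : (b * B + l) / B = b := by
      rw [mul_comm, Nat.mul_add_div hB, Nat.div_eq_of_lt (Finset.mem_range.1 hl), add_zero]
    rw [place, this]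
  rw [blockSum, Finset.sum_congr rfl h1, Finset.sum_add_distrib, ← Finset.mul_sum,
    ← Finset.sum_div]
  change _ * (blockSum p B b / blockSum p B b) + _ = _
  rw [Finset.sum_const, Finset.card_range, nsmul_eq_mul, mul_div_cancel₀ _ h0]
  rcases eq_or_ne (blockSum p B b) 0 with hP | hP
  · simp [hP, excess]
  · rw [div_self hP, mul_one, excess]
    rcases le_total (batch z B p r b) ((1 + z) * blockSum p B b) with h | h
    · rw [min_eq_left h, tsub_eq_zero_of_le h, add_zero]
    · rw [min_eq_right h, add_tsub_cancel_of_le h]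

lemma place_le (j : ℕ) : place z B p r j ≤ (1 + z) * p j + excess z B p r (j / B) / B := by
  refine add_le_add_left ?_ _
  rcases eq_or_ne (blockSum p B (j / B)) 0 with hP | hP
  · simp [hP]
  · calc _ ≤ ((1 + z) * blockSum p B (j / B)) * (p j / blockSum p B (j / B)) := by
          gcongr; exact min_le_right _ _
      _ = _ := by field_simp

lemma place_eq_zero {j : ℕ} (h : batch z B p r (j / B) = 0) : place z B p r j = 0 := by
  simp [place, excess, h]

lemma overlap_eq_zero {b : ℕ} (h : batch z B p r b = 0) (i : ℕ) : overlap z B p r i b = 0 :=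
  tsub_eq_zero_of_le (((min_le_right _ _).trans (tsub_eq_zero_iff_le.1 h)).trans (le_max_right _ _))

/-- The lengths of the intersections of `[x, y]` with consecutive intervals add up. -/
lemma sum_inter_length {g : ℕ → ℝ≥0} (hg : Monotone g) {x y : ℝ≥0} (hxy : x ≤ y) (K : ℕ) :
    ∑ b ∈ Finset.range K, (min y (g (b + 1)) - max x (g b)) = min y (g K) - max x (g 0) := by
  induction K with
  | zero =>
    refine (tsub_eq_zero_of_le ?_).symm
    exact (min_le_right _ _).trans (le_max_right _ _)
  | succ K ih =>
    rw [Finset.sum_range_succ, ih]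
    have h1 : g 0 ≤ g K := hg K.zero_le
    have h2 : g K ≤ g (K + 1) := hg K.le_succ
    rw [← NNReal.coe_inj]
    simp only [NNReal.coe_add, NNReal.coe_sub_def, NNReal.coe_max, NNReal.coe_min]
    rw [← NNReal.coe_le_coe] at h1 h2 hxy
    grind

lemma sum_flow_slots (hB : 0 < B) {i K : ℕ} (h : cum r (i + 1) ≤ front z B p r K) :
    cum (flow z B p r i) (K * B) = r i := by
  have h1 : ∀ b ∈ Finset.range K, blockSum (flow z B p r i) B b = overlap z B p r i b := by
    intro b _
    have h2 : ∀ l ∈ Finset.range B, flow z B p r i (b * B + l) =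
        overlap z B p r i b * (place z B p r (b * B + l) / batch z B p r b) := by
      intro l hl
      have : (b * B + l) / B = b := by
        rw [mul_comm, Nat.mul_add_div hB, Nat.div_eq_of_lt (Finset.mem_range.1 hl), add_zero]
      rw [flow, this]
    rw [blockSum, Finset.sum_congr rfl h2, ← Finset.mul_sum, ← Finset.sum_div]
    change _ * (blockSum (place z B p r) B b / _) = _
    rw [sum_place z p r hB]
    rcases eq_or_ne (batch z B p r b) 0 with h0 | h0
    · simp [overlap_eq_zero z p r h0]
    · rw [div_self h0, mul_one]
  rw [cum_mul, Finset.sum_congr rfl h1]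
  refine (sum_inter_length (front_mono z B p r) (cum_mono r i.le_succ) K).trans ?_
  rw [min_eq_left h, front, max_eq_left zero_le, cum_succ, add_tsub_cancel_left]

lemma sum_flow_jobs {j L : ℕ} (h : front z B p r (j / B + 1) ≤ cum r L) :
    ∑ i ∈ Finset.range L, flow z B p r i j = place z B p r j := by
  have h1 : ∑ i ∈ Finset.range L, overlap z B p r i (j / B) = batch z B p r (j / B) := by
    have := sum_inter_length (cum_mono r) (front_mono z B p r (j / B).le_succ) L
    simp only [overlap, batch]
    simp only [min_comm (cum r _), max_comm (cum r _)]
    rw [this, min_eq_left h]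
    simp [cum]
  simp only [flow]
  rw [← Finset.sum_mul, h1]
  rcases eq_or_ne (batch z B p r (j / B)) 0 with h0 | h0
  · simp [place_eq_zero z p r h0, h0]
  · exact mul_div_cancel₀ _ h0

lemma flow_support (hB : 0 < B) {i j : ℕ} (h : flow z B p r i j ≠ 0) :
    i < j + 2 * B ∧ j < i + 2 * B := by
  have h1 : max (cum r i) (front z B p r (j / B)) <
      min (cum r (i + 1)) (front z B p r (j / B + 1)) := by
    by_contra h0
    exact left_ne_zero_of_mul h (tsub_eq_zero_of_le (not_lt.1 h0))
  obtain ⟨h2, h3⟩ := lt_min_iff.1 h1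
  have h4 := (cum_mono r).reflect_lt
    (((le_max_left _ _).trans_lt h3).trans_le (front_le_cum z B p r _))
  have h5 := (le_max_right _ _).trans_lt h2
  have h6 : j < (j / B + 1) * B := by
    rw [mul_comm]; exact Nat.lt_mul_div_succ j hB
  have h7 : j / B * B ≤ j := Nat.div_mul_le_self j B
  generalize j / B = b at *
  constructor
  · linarith
  · cases b with
    | zero => linarith
    | succ b =>
      have := (cum_mono r).reflect_lt ((cum_le_front_succ z B p r b).trans_lt h5)
      linarith

variable {p r} {r' : ℕ → ℝ≥0}

lemma cum_congr {n : ℕ} (h : ∀ i < n, r i = r' i) : cum r n = cum r' n :=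
  Finset.sum_congr rfl fun i hi ↦ h i (Finset.mem_range.1 hi)

lemma front_congr {b : ℕ} (h : ∀ i < (b + 1) * B, r i = r' i) :
    front z B p r b = front z B p r' b := by
  induction b with
  | zero => rfl
  | succ b ih =>
    rw [front, front, ih fun i hi ↦ h i (hi.trans_le (by gcongr; omega)), cum_congr h,
      cum_congr fun i hi ↦ h i (hi.trans_le (by gcongr; omega))]

lemma batch_congr {j : ℕ} (h : ∀ i < j + 2 * B, r i = r' i) :
    batch z B p r (j / B) = batch z B p r' (j / B) := by
  have h7 : j / B * B ≤ j := Nat.div_mul_le_self j B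
  rw [batch, batch, front_congr z fun i hi ↦ h i (by linarith),
    front_congr z fun i hi ↦ h i (by linarith)]

/-- What is placed on slot `j` only depends on the work released before `j + 2 B`. -/
lemma place_congr {j : ℕ} (h : ∀ i < j + 2 * B, r i = r' i) :
    place z B p r j = place z B p r' j := by
  rw [place, place, excess, excess, batch_congr z h]

lemma flow_congr (hB : 0 < B) {j : ℕ} (h : ∀ i < j + 2 * B, r i = r' i) (i : ℕ) :
    flow z B p r i j = flow z B p r' i j := by
  by_cases hi : i < j + 2 * B
  · have h7 : j / B * B ≤ j := Nat.div_mul_le_self j B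
    rw [flow, flow, place_congr z h, batch_congr z h, overlap, overlap,
      front_congr z fun i hi ↦ h i (by linarith), front_congr z fun i hi ↦ h i (by linarith),
      cum_congr fun k hk ↦ h k (by omega), cum_congr fun k hk ↦ h k (by omega)]
  · have h1 : ∀ r, flow z B p r i j = 0 := fun r ↦ by_contra fun h0 ↦
      hi (flow_support z p r hB h0).1
    rw [h1, h1]

end Flow

section Excess

lemma add_rpow_le_two_rpow_mul {α : ℝ} (hα : 0 ≤ α) (u v : ℝ≥0) :
    (u + v) ^ α ≤ 2 ^ α * (u ^ α + v ^ α) := by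
  rw [mul_add, ← NNReal.mul_rpow, ← NNReal.mul_rpow]
  rcases le_total u v with h | h
  · refine le_add_left (NNReal.rpow_le_rpow ?_ hα)
    rw [two_mul]; gcongr
  · refine le_add_right (NNReal.rpow_le_rpow ?_ hα)
    rw [two_mul]; gcongr

/-- A sequence that loses the fraction `z / (1 + z)` of its value every other step, and gains `x`,
is bounded by `x / z` in the `α`-norm. -/
lemma sum_rpow_le_of_recurrence {α : ℝ} (hα : 1 ≤ α) {z : ℝ≥0} (hz : z ≠ 0) {a x : ℕ → ℝ≥0}
    (h0 : a 0 = 0) (h1 : a 1 = 0) (h : ∀ n, (1 + z) * a (n + 2) ≤ a n + x n) (K : ℕ) :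
    ∑ n ∈ Finset.range K, a (n + 2) ^ α ≤ ∑ n ∈ Finset.range K, (x n / z) ^ α := by
  have hα0 : α ≠ 0 := by linarith
  have hz1 : 1 + z ≠ 0 := by positivity
  have step : ∀ n, (1 + z) * a (n + 2) ^ α ≤ a n ^ α + z * (x n / z) ^ α := by
    intro n
    have h2 : a (n + 2) ≤ (1 / (1 + z)) * a n + (z / (1 + z)) * (x n / z) := by
      have h3 : (1 / (1 + z)) * a n + (z / (1 + z)) * (x n / z) = (a n + x n) / (1 + z) := by
        field_simp
      rw [h3, le_div_iff₀ (by positivity), mul_comm]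
      exact h n
    have h3 := (NNReal.rpow_le_rpow h2 (by linarith)).trans
      (NNReal.rpow_arith_mean_le_arith_mean2_rpow (1 / (1 + z)) (z / (1 + z)) (a n) (x n / z)
        (by field_simp) hα)
    calc (1 + z) * a (n + 2) ^ α
        ≤ (1 + z) * (1 / (1 + z) * a n ^ α + z / (1 + z) * (x n / z) ^ α) := by gcongr
      _ = _ := by field_simp
  set S := ∑ n ∈ Finset.range K, a (n + 2) ^ α with hS
  have hshift : ∑ n ∈ Finset.range K, a n ^ α ≤ S := by
    calc ∑ n ∈ Finset.range K, a n ^ α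
        ≤ ∑ n ∈ Finset.range (K + 2), a n ^ α :=
          Finset.sum_le_sum_of_subset (Finset.range_mono (by omega))
      _ = S := by
          rw [Finset.sum_range_succ', Finset.sum_range_succ']
          simp [h0, h1, hα0, hS]
  have hsum := Finset.sum_le_sum fun n (_ : n ∈ Finset.range K) ↦ step n
  rw [← Finset.mul_sum, Finset.sum_add_distrib, ← Finset.mul_sum, add_mul, one_mul] at hsum
  have h2 : S + z * S ≤ S + z * ∑ n ∈ Finset.range K, (x n / z) ^ α :=
    hsum.trans (by gcongr)
  exact le_of_mul_le_mul_left (le_of_add_le_add_left h2) (pos_iff_ne_zero.2 hz)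

/-- How far the matching lags behind an offline matching, which matches the prediction `p` to the
work `w`: the difference of the amounts of work that are released before block `n + 1` and not
yet matched to the blocks of the prediction before `n`. -/
noncomputable def lag (z : ℝ≥0) (B : ℕ) (p r w : ℕ → ℝ≥0) (n : ℕ) : ℝ :=
  (cum r ((n + 1) * B) - front z B p r n) - (cum w ((n + 1) * B) - cum p (n * B))

variable {z : ℝ≥0} {B : ℕ} {p r w d : ℕ → ℝ≥0}

lemma blockSum_sub_le (h : ∀ i, r i ≤ w i + d i) (k : ℕ) :
    (blockSum r B k : ℝ) ≤ blockSum w B k + blockSum d B k := by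
  have : blockSum r B k ≤ blockSum w B k + blockSum d B k := by
    rw [blockSum, blockSum, blockSum, ← Finset.sum_add_distrib]
    exact Finset.sum_le_sum fun _ _ ↦ h _
  exact_mod_cast this

lemma coe_cum_succ_mul (f : ℕ → ℝ≥0) (B n : ℕ) :
    (cum f ((n + 1) * B) : ℝ) = cum f (n * B) + blockSum f B n := by
  exact_mod_cast cum_add_blockSum f B n

lemma lag_zero_le (hrw : ∀ i, r i ≤ w i + d i) : lag z B p r w 0 ≤ blockSum d B 0 := by
  have h1 := blockSum_sub_le (B := B) hrw 0
  have h2 := coe_cum_succ_mul r B 0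
  have h3 := coe_cum_succ_mul w B 0
  simp only [lag, front, zero_mul] at *
  simp only [cum, Finset.range_zero, Finset.sum_empty, NNReal.coe_zero] at *
  linarith

/-- The lag vanishes when the queue is emptied, and otherwise it is reduced by the additional
capacity `z` of the matching. -/
lemma lag_succ_le (hrw : ∀ i, r i ≤ w i + d i)
    (hpw : ∀ k, cum p (k * B) ≤ cum w ((k + 1) * B)) (b : ℕ) :
    lag z B p r w (b + 1) ≤ 0 ∨
      lag z B p r w (b + 1) ≤ lag z B p r w b + blockSum d B (b + 1) - z * blockSum p B b := by
  have h1 := blockSum_sub_le (B := B) hrw (b + 1)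
  have h2 := coe_cum_succ_mul r B (b + 1)
  have h3 := coe_cum_succ_mul w B (b + 1)
  have h4 := coe_cum_succ_mul p B b
  have h5 : (cum p ((b + 1) * B) : ℝ) ≤ cum w ((b + 1 + 1) * B) := by exact_mod_cast hpw (b + 1)
  simp only [lag]
  rcases le_total (cum r ((b + 2) * B)) (front z B p r b + (1 + z) * blockSum p B b) with h | h
  · left
    have h6 : front z B p r (b + 1) = cum r ((b + 2) * B) := by
      rw [front, min_eq_right h, max_eq_left (cum_mono _ (by gcongr; omega))]
    rw [h6]
    linarith
  · right
    have h6 : (front z B p r b : ℝ) + (1 + z) * blockSum p B b ≤ front z B p r (b + 1) := by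
      have : front z B p r b + (1 + z) * blockSum p B b ≤ front z B p r (b + 1) := by
        rw [front, min_eq_left h]; exact le_max_left _ _
      exact_mod_cast this
    linarith

/-- The offline matching is at most two blocks of the prediction ahead. -/
lemma lag_add_two_le (hrw : ∀ i, r i ≤ w i + d i)
    (hpw : ∀ k, cum p (k * B) ≤ cum w ((k + 1) * B)) (n : ℕ) :
    lag z B p r w (n + 2) ≤ blockSum d B (n + 1) + blockSum d B (n + 2) + blockSum p B n +
      blockSum p B (n + 1) := by
  have h1 := blockSum_sub_le (B := B) hrw (n + 1)
  have h1' := blockSum_sub_le (B := B) hrw (n + 2)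
  have h2 := coe_cum_succ_mul r B (n + 1)
  have h2' := coe_cum_succ_mul r B (n + 2)
  have h3 := coe_cum_succ_mul w B (n + 1)
  have h3' := coe_cum_succ_mul w B (n + 2)
  have h4 := coe_cum_succ_mul p B n
  have h4' := coe_cum_succ_mul p B (n + 1)
  have h5 : (cum p (n * B) : ℝ) ≤ cum w ((n + 1) * B) := by exact_mod_cast hpw n
  have h6 : (cum r ((n + 1) * B) : ℝ) ≤ front z B p r (n + 2) := by
    exact_mod_cast cum_le_front_succ z B p r (n + 1)
  simp only [lag]
  simp only [add_assoc, Nat.reduceAdd] at *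
  linarith

/-- If block `b` has an excess, then the matching has just reached the end of block `b - 1`, whereas
the offline matching has already finished these blocks; so the excess is part of the lag. -/
lemma excess_le (hwr : ∀ i, w i ≤ r i + d i)
    (hwp : ∀ k, cum w (k * B) ≤ cum p ((k + 1) * B)) (b : ℕ) :
    excess z B p r b ≤ (lag z B p r w b).toNNReal + blockSum d B b := by
  rcases le_total (front z B p r (b + 1)) (front z B p r b + (1 + z) * blockSum p B b) with h | h
  · have : excess z B p r b = 0 := by
      rw [excess, batch, tsub_tsub, tsub_eq_zero_of_le h]
    simp [this]
  · rcases h.eq_or_lt with h | h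
    · have : excess z B p r b = 0 := by
        rw [excess, batch, tsub_tsub, tsub_eq_zero_of_le h.ge]
      simp [this]
    · have h1 := blockSum_sub_le (B := B) hwr b
      have h2 := coe_cum_succ_mul r B b
      have h3 := coe_cum_succ_mul w B b
      have h4 := coe_cum_succ_mul p B b
      have h5 : (cum w (b * B) : ℝ) ≤ cum p ((b + 1) * B) := by exact_mod_cast hwp b
      have h6 : front z B p r (b + 1) = cum r (b * B) := by
        rw [front] at h ⊢
        refine max_eq_right ?_
        rcases lt_max_iff.1 h with h' | h'
        · exact absurd ((min_le_left _ _).trans_lt' h') (lt_irrefl _)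
        · exact (min_le_left _ _).trans h'.le
      have h7 : (excess z B p r b : ℝ) =
          cum r (b * B) - (front z B p r b + (1 + z) * blockSum p B b) := by
        rw [excess, batch, tsub_tsub, NNReal.coe_sub h.le, h6]
        push_cast
        ring
      have h8 : 0 ≤ (z : ℝ) * blockSum p B b := by positivity
      rw [← NNReal.coe_le_coe, h7]
      push_cast
      have h9 := Real.le_coe_toNNReal (lag z B p r w b)
      simp only [lag] at h9 ⊢
      linarith

/-- Over two steps the additional capacity amounts to `z` times the total of two blocks of the
prediction, which is at least `z` times the lag, up to errors. -/
lemma lag_recurrence (hz : z ≤ 1) (hrw : ∀ i, r i ≤ w i + d i)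
    (hpw : ∀ k, cum p (k * B) ≤ cum w ((k + 1) * B)) (n : ℕ) :
    (1 + z) * (lag z B p r w (n + 2)).toNNReal ≤ (lag z B p r w n).toNNReal +
      2 * (blockSum d B (n + 1) + blockSum d B (n + 2)) := by
  rcases le_or_gt (lag z B p r w (n + 2)) 0 with h | h
  · simp [Real.toNNReal_of_nonpos h]
  · rw [← NNReal.coe_le_coe]
    push_cast
    rw [Real.coe_toNNReal _ h.le, Real.coe_toNNReal']
    have hz' : (z : ℝ) ≤ 1 := by exact_mod_cast hz
    have hz0 : 0 ≤ (z : ℝ) := z.2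
    have e1 : 0 ≤ (blockSum d B (n + 1) : ℝ) := NNReal.coe_nonneg _
    have e2 : 0 ≤ (blockSum d B (n + 2) : ℝ) := NNReal.coe_nonneg _
    have e3 : 0 ≤ (blockSum p B n : ℝ) := NNReal.coe_nonneg _
    have e4 : 0 ≤ (blockSum p B (n + 1) : ℝ) := NNReal.coe_nonneg _
    have h0 := le_max_left (lag z B p r w n) 0
    have h0' := le_max_right (lag z B p r w n) 0
    have h1 := (lag_succ_le (z := z) hrw hpw (n + 1)).resolve_left (not_le.2 h)
    rcases lag_succ_le (z := z) hrw hpw n with h2 | h2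
    · have h3 : lag z B p r w (n + 2) ≤ blockSum d B (n + 2) := by
        have := mul_nonneg hz0 e4
        linarith
      nlinarith
    · have h3 := mul_le_mul_of_nonneg_left (lag_add_two_le (z := z) hrw hpw n) hz0
      nlinarith

/-- The excess of the matching is controlled, in the `α`-norm over the blocks, by the distance of
the actual work from any work that can be matched to the prediction. -/
lemma sum_excess_rpow_le {α : ℝ} (hα : 1 ≤ α) (hz0 : z ≠ 0) (hz : z ≤ 1)
    (hrw : ∀ i, r i ≤ w i + d i) (hwr : ∀ i, w i ≤ r i + d i)
    (hpw : ∀ k, cum p (k * B) ≤ cum w ((k + 1) * B))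
    (hwp : ∀ k, cum w (k * B) ≤ cum p ((k + 1) * B)) (K : ℕ) :
    ∑ b ∈ Finset.range K, excess z B p r b ^ α ≤
      (32 / z) ^ α * ∑ b ∈ Finset.range K, blockSum d B b ^ α := by
  have hα0 : 0 ≤ α := by linarith
  set ε := blockSum d B with hε
  set E := ∑ b ∈ Finset.range K, ε b ^ α with hE
  set ℓ : ℕ → ℝ≥0 := fun n ↦ (lag z B p r w n).toNNReal with hℓ
  -- the lag, preceded by two zeros, so that its first two values need no special treatment
  set a : ℕ → ℝ≥0 := fun n ↦ n.casesOn 0 fun n ↦ n.casesOn 0 ℓ with ha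
  have hℓ0 : ℓ 0 ≤ ε 0 := by
    simp only [hℓ, hε, Real.toNNReal_le_iff_le_coe]
    exact lag_zero_le hrw
  have hℓ1 : ℓ 1 ≤ ℓ 0 + ε 1 := by
    simp only [hℓ, hε, Real.toNNReal_le_iff_le_coe]
    rcases lag_succ_le (z := z) hrw hpw 0 with h | h
    · exact h.trans (NNReal.coe_nonneg _)
    · have h1 := Real.le_coe_toNNReal (lag z B p r w 0)
      have h2 : 0 ≤ (z : ℝ) * blockSum p B 0 := by positivity
      push_cast at *
      linarith
  have hrec : ∀ n, (1 + z) * a (n + 2) ≤ a n + 2 * (ε (n - 1) + ε n) := by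
    intro n
    have hz2 : 1 + z ≤ 2 := by
      calc 1 + z ≤ 1 + 1 := by gcongr
        _ = 2 := one_add_one_eq_two
    match n with
    | 0 =>
      calc (1 + z) * ℓ 0 ≤ 2 * (0 + ε 0) := by rw [zero_add]; gcongr
        _ ≤ 0 + 2 * (ε 0 + ε 0) := by simp only [zero_add]; gcongr; exact le_self_add
    | 1 =>
      calc (1 + z) * ℓ 1 ≤ 2 * (ε 0 + ε 1) := by gcongr; exact hℓ1.trans (by gcongr)
        _ = 0 + 2 * (ε 0 + ε 1) := (zero_add _).symm
    | n + 2 => exact lag_recurrence hz hrw hpw n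
  have hshift : ∑ n ∈ Finset.range K, ε (n - 1) ^ α ≤ 2 * E := by
    rw [two_mul]
    cases K with
    | zero => simp
    | succ K =>
      rw [Finset.sum_range_succ']
      refine add_le_add ?_ ?_
      · exact Finset.sum_le_sum_of_subset (f := fun n ↦ ε n ^ α) (Finset.range_mono K.le_succ)
      · exact Finset.single_le_sum (f := fun n ↦ ε n ^ α) (fun _ _ ↦ zero_le)
          (Finset.mem_range.2 K.succ_pos)
  have hsum : ∑ n ∈ Finset.range K, ℓ n ^ α ≤ (4 / z) ^ α * (3 * E) := by
    calc ∑ n ∈ Finset.range K, ℓ n ^ α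
        ≤ ∑ n ∈ Finset.range K, (2 * (ε (n - 1) + ε n) / z) ^ α :=
          sum_rpow_le_of_recurrence (a := a) hα hz0 rfl rfl hrec K
      _ ≤ ∑ n ∈ Finset.range K, (4 / z) ^ α * (ε (n - 1) ^ α + ε n ^ α) := by
          refine Finset.sum_le_sum fun n _ ↦ ?_
          rw [mul_div_right_comm, NNReal.mul_rpow, show (4 : ℝ≥0) / z = 2 / z * 2 by ring,
            NNReal.mul_rpow, mul_assoc]
          gcongr
          exact add_rpow_le_two_rpow_mul hα0 _ _
      _ ≤ (4 / z) ^ α * (3 * E) := by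
          rw [← Finset.mul_sum, Finset.sum_add_distrib]
          gcongr
          calc _ ≤ 2 * E + E := by gcongr
            _ = 3 * E := by ring
  have h1 : (1 : ℝ≥0) ≤ (4 / z) ^ α := by
    refine NNReal.one_le_rpow ?_ hα0
    rw [le_div_iff₀ (pos_iff_ne_zero.2 hz0), one_mul]
    exact hz.trans (by norm_num)
  have h4 : (4 : ℝ≥0) ≤ 4 ^ α := by
    simpa using NNReal.rpow_le_rpow_of_exponent_le (x := 4) (by norm_num) hα
  calc ∑ b ∈ Finset.range K, excess z B p r b ^ α
      ≤ ∑ b ∈ Finset.range K, 2 ^ α * (ℓ b ^ α + ε b ^ α) :=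
        Finset.sum_le_sum fun b _ ↦ (NNReal.rpow_le_rpow (excess_le hwr hwp b) hα0).trans
          (add_rpow_le_two_rpow_mul hα0 _ _)
    _ ≤ 2 ^ α * ((4 / z) ^ α * (3 * E) + (4 / z) ^ α * E) := by
        rw [← Finset.mul_sum, Finset.sum_add_distrib]
        gcongr
        exact le_mul_of_one_le_left zero_le h1
    _ = 2 ^ α * (4 * (4 / z) ^ α) * E := by ring
    _ ≤ 2 ^ α * (4 ^ α * (4 / z) ^ α) * E := by gcongr
    _ = (32 / z) ^ α * E := by
        rw [← NNReal.mul_rpow, ← NNReal.mul_rpow]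
        congr 2
        ring

/-- Spreading the excess of a block uniformly over its slots, and Jensen's inequality for the
errors within a block, turn the bound for the blocks into one for the slots. -/
lemma sum_excess_div_rpow_le {α : ℝ} (hα : 1 ≤ α) (hB : 0 < B) (hz0 : z ≠ 0) (hz : z ≤ 1)
    (hrw : ∀ i, r i ≤ w i + d i) (hwr : ∀ i, w i ≤ r i + d i)
    (hpw : ∀ k, cum p (k * B) ≤ cum w ((k + 1) * B))
    (hwp : ∀ k, cum w (k * B) ≤ cum p ((k + 1) * B)) (K : ℕ) :
    cum (fun j ↦ (excess z B p r (j / B) / B) ^ α) (K * B) ≤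
      (32 / z) ^ α * cum (fun j ↦ d j ^ α) (K * B) := by
  have h0 : (B : ℝ≥0) ≠ 0 := by exact_mod_cast hB.ne'
  have hBα : (B : ℝ≥0) ^ α ≠ 0 := by simp [h0]
  have h1 : ∀ b, blockSum (fun j ↦ (excess z B p r (j / B) / B) ^ α) B b =
      B / B ^ α * excess z B p r b ^ α := by
    intro b
    have h2 : ∀ l ∈ Finset.range B, (excess z B p r ((b * B + l) / B) / B) ^ α =
        (excess z B p r b / B) ^ α := by
      intro l hl
      rw [mul_comm, Nat.mul_add_div hB, Nat.div_eq_of_lt (Finset.mem_range.1 hl), add_zero]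
    rw [blockSum, Finset.sum_congr rfl h2, Finset.sum_const, Finset.card_range, nsmul_eq_mul,
      NNReal.div_rpow]
    ring
  have h3 : ∀ b, (B : ℝ≥0) / B ^ α * blockSum d B b ^ α ≤ blockSum (fun j ↦ d j ^ α) B b := by
    intro b
    have := NNReal.rpow_sum_le_const_mul_sum_rpow (Finset.range B) (fun l ↦ d (b * B + l)) hα
    rw [Finset.card_range, NNReal.rpow_sub_one h0] at this
    calc (B : ℝ≥0) / B ^ α * blockSum d B b ^ α
        ≤ (B : ℝ≥0) / B ^ α * ((B : ℝ≥0) ^ α / B * blockSum (fun j ↦ d j ^ α) B b) := by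
          gcongr; exact this
      _ = _ := by field_simp
  rw [cum_mul, cum_mul]
  simp only [h1]
  rw [← Finset.mul_sum]
  calc _ ≤ (B : ℝ≥0) / B ^ α * ((32 / z) ^ α * ∑ b ∈ Finset.range K, blockSum d B b ^ α) := by
        gcongr
        exact sum_excess_rpow_le hα hz0 hz hrw hwr hpw hwp K
    _ = (32 / z) ^ α * ∑ b ∈ Finset.range K, (B : ℝ≥0) / B ^ α * blockSum d B b ^ α := by
        rw [← Finset.mul_sum]; ring
    _ ≤ _ := by
        gcongr with b _
        exact h3 b

end Excess

/-! ### The noise-robust algorithm -/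

/-- A sequence delayed by two blocks of length `B`. -/
def delay (B : ℕ) (f : ℕ → ℝ≥0) (m : ℕ) : ℝ≥0 := if 2 * B ≤ m then f (m - 2 * B) else 0

section Matched

variable (z : ℝ≥0) (B : ℕ) (pred real : Workload D T)

/-- The prediction for the instance with windows of length `D - 4 B`: the original one with
capacity increased by the factor `1 + z`, delayed by two blocks. -/
noncomputable def matchedPred : Workload (D - 4 * B) T :=
  fun m ↦ delay B (fun j ↦ (1 + z) * extend pred j) m

/-- The actual work, moved to the locations to which it is matched, delayed by two blocks: when a
block begins, the work which is placed there has already been released. -/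
noncomputable def matchedWork : Workload (D - 4 * B) T :=
  fun m ↦ delay B (place z B (extend pred) (extend real)) m

/-- The amount of work released at `i` that is moved to `m`. -/
noncomputable def matchedFlow (i : Fin (T - D + 1)) (m : Fin (T - (D - 4 * B) + 1)) : ℝ≥0 :=
  delay B (flow z B (extend pred) (extend real) i) m

variable {z B}

lemma sum_delay (hDT : D ≤ T) (hBD : 8 * B < D) (f : ℕ → ℝ≥0) :
    ∑ m : Fin (T - (D - 4 * B) + 1), delay B f m = cum f (T - D + 2 * B + 1) := by
  rw [Fin.sum_univ_eq_sum_range, show T - (D - 4 * B) + 1 = 2 * B + (T - D + 2 * B + 1) by omega,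
    Finset.sum_range_add, Finset.sum_eq_zero, zero_add]
  · exact Finset.sum_congr rfl fun j _ ↦ by simp [delay]
  · intro m hm
    simp only [delay]
    rw [if_neg (not_le.2 (Finset.mem_range.1 hm))]

lemma cum_extend_of_le (w : Workload D T) {n : ℕ} (h : T - D + 1 ≤ n) :
    cum (extend w) n = ∑ i, w i := by
  rw [cum_extend]
  exact Finset.sum_congr rfl fun i _ ↦ if_pos (i.2.trans_le h)

lemma cum_extend_le (w : Workload D T) (n : ℕ) :
    cum (extend w) n ≤ cum (extend w) (T - D + 1) := by
  rw [cum_extend_of_le w le_rfl, cum_extend]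
  exact Finset.sum_le_sum fun i _ ↦ by split_ifs <;> simp

lemma extend_rpow {α : ℝ} (hα : 0 < α) (w : Workload D T) (n : ℕ) :
    extend w n ^ α = extend (fun i ↦ w i ^ α : Workload D T) n := by
  unfold extend
  split_ifs
  · rfl
  · exact NNReal.zero_rpow hα.ne'

lemma sum_matchedFlow_slots (hB : 0 < B) (hDT : D ≤ T) (hBD : 8 * B < D) (i) :
    ∑ m, matchedFlow z B pred real i m = real i := by
  have h1 : T - D + 1 ≤ (T - D + 1) * B := Nat.le_mul_of_pos_right _ hB
  have hK := sum_flow_slots z (extend pred) (extend real) hB (i := i) (K := T - D + 2 + 1)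
    ((cum_mono _ (by have := i.2; linarith)).trans (cum_le_front_succ z B _ _ _))
  rw [extend_coe] at hK
  rw [← hK]
  refine (sum_delay hDT hBD _).trans
    (Finset.sum_subset (Finset.range_mono (by linarith)) fun j _ hj ↦ ?_)
  by_contra h0
  have h2 := (flow_support z _ _ hB h0).2
  have h3 := i.2
  simp only [Finset.mem_range, not_lt] at hj
  omega

lemma sum_matchedFlow_jobs (m) :
    ∑ i, matchedFlow z B pred real i m = matchedWork z B pred real m := by
  simp only [matchedFlow, matchedWork, delay]
  split_ifs
  · rw [Fin.sum_univ_eq_sum_range (fun i ↦ flow z B (extend pred) (extend real) i _)]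
    exact sum_flow_jobs z _ _ ((front_le_cum z B _ _ _).trans (cum_extend_le real _))
  · simp

lemma matchedFlow_support (hB : 0 < B) {i : Fin (T - D + 1)} {m : Fin (T - (D - 4 * B) + 1)}
    (h : matchedFlow z B pred real i m ≠ 0) : (i : ℕ) ≤ m ∧ (m : ℕ) ≤ i + 4 * B := by
  simp only [matchedFlow, delay] at h
  split_ifs at h with hm
  · have := flow_support z _ _ hB h
    omega
  · exact absurd rfl h

lemma extend_congr {real' : Workload D T} {n : ℕ}
    (h : ∀ j : Fin (T - D + 1), (j : ℕ) ≤ n → real j = real' j) {i : ℕ} (hi : i ≤ n) :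
    extend real i = extend real' i := by
  unfold extend
  split_ifs with h1
  · exact h _ hi
  · rfl

/-- What is moved to `m` only depends on the work released up to `m`. -/
lemma matched_congr (hB : 0 < B) {real' : Workload D T} (m : Fin (T - (D - 4 * B) + 1))
    (h : ∀ j : Fin (T - D + 1), (j : ℕ) ≤ m → real j = real' j) :
    matchedWork z B pred real m = matchedWork z B pred real' m ∧
      ∀ i, matchedFlow z B pred real i m = matchedFlow z B pred real' i m := by
  simp only [matchedWork, matchedFlow, delay]
  split_ifs with hm
  · have h1 : ∀ i < (m : ℕ) - 2 * B + 2 * B, extend real i = extend real' i := fun i hi ↦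
      extend_congr real h (by omega)
    exact ⟨place_congr z h1, fun i ↦ flow_congr z hB h1 i⟩
  · simp

/-- The schedule of the actual workload that results from processing the moved work with `A`. -/
noncomputable def matchedSchedule (z : ℝ≥0) (B : ℕ) (A : OnlineAlgorithm)
    (pred real : Workload D T) : Schedule D T :=
  resplit (matchedWork z B pred real) (fun m i ↦ matchedFlow z B pred real i m)
    (A.run (D - 4 * B) T (matchedPred z B pred) (matchedWork z B pred real))

lemma feasible_matchedSchedule (A : OnlineAlgorithm) (hB : 0 < B) (hDT : D ≤ T)
    (hBD : 8 * B < D) : Feasible real (matchedSchedule z B A pred real) := by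
  have hA := A.feasible (D - 4 * B) T (by omega) (by omega) (matchedPred z B pred)
    (matchedWork z B pred real)
  refine feasible_resplit hA.measurable hA.lintegral
    (fun m ↦ (sum_matchedFlow_jobs pred real m).le)
    (fun i ↦ sum_matchedFlow_slots pred real hB hDT hBD i) fun m i t hne ht ↦ ?_
  have h1 := matchedFlow_support pred real hB hne
  have h2 := hA.mem_Icc ht
  have h3 : ((i : ℕ) : ℝ) ≤ (m : ℕ) := by exact_mod_cast h1.1
  have h4 : ((m : ℕ) : ℝ) + (D - 4 * B : ℕ) ≤ (i : ℕ) + D := by exact_mod_cast (by omega)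
  exact ⟨h3.trans h2.1, h2.2.trans h4⟩

lemma online_matchedSchedule (A : OnlineAlgorithm) (hB : 0 < B) (hDT : D ≤ T)
    (hBD : 8 * B < D) {real' : Workload D T} {t : ℝ}
    (h : ∀ j : Fin (T - D + 1), ((j : ℕ) : ℝ) ≤ t → real j = real' j) (i : Fin (T - D + 1)) :
    matchedSchedule z B A pred real i t = matchedSchedule z B A pred real' i t := by
  simp only [matchedSchedule, resplit]
  refine Finset.sum_congr rfl fun m _ ↦ ?_
  have hA := fun r ↦ A.feasible (D - 4 * B) T (by omega) (by omega) (matchedPred z B pred)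
    (matchedWork z B pred r)
  by_cases hm : ((m : ℕ) : ℝ) ≤ t
  · have hc : ∀ m' : Fin (T - (D - 4 * B) + 1), ((m' : ℕ) : ℝ) ≤ t → _ := fun m' hm' ↦
      matched_congr (z := z) pred real hB m' fun j hj ↦
        h j ((Nat.cast_le.2 hj).trans hm')
    rw [(hc m hm).1, (hc m hm).2, A.online (D - 4 * B) T (by omega) (by omega) _ _ _ t
      fun m' hm' ↦ (hc m' hm').1]
  · have h0 : ∀ r, A.run (D - 4 * B) T (matchedPred z B pred) (matchedWork z B pred r) m t = 0 :=
      fun r ↦ by_contra fun h0 ↦ hm ((hA r).mem_Icc h0).1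
    rw [h0, h0, mul_zero, mul_zero]

end Matched

/-- The conversion for small parameters `z`. If `z D < 1`, no work is moved and `A` itself is used.
Otherwise the work is matched in blocks of length `⌊z D⌋`; the second condition, which keeps the
shortened windows nonempty, is automatic for `z < 1 / 16`. -/
noncomputable def matchingAlgorithm (z : ℝ≥0) (A : OnlineAlgorithm) : OnlineAlgorithm where
  run D T pred real :=
    if 0 < ⌊z * D⌋₊ ∧ 8 * ⌊z * D⌋₊ < D then matchedSchedule z ⌊z * D⌋₊ A pred real
    else A.run D T pred real
  feasible D T hD hDT pred real := by
    split_ifs with h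
    · exact feasible_matchedSchedule pred real A h.1 hDT h.2
    · exact A.feasible D T hD hDT pred real
  online D T hD hDT pred real real' t h i := by
    split_ifs with hB
    · exact online_matchedSchedule pred real A hB.1 hDT hB.2 h i
    · exact A.online D T hD hDT pred real real' t h i

/-- The conversion of the theorem: for large parameters the average rate schedule is good enough. -/
noncomputable def noiseRobust (η ζ : ℝ) (A : OnlineAlgorithm) : OnlineAlgorithm :=
  if (max η ζ).toNNReal < 1 / 16 then matchingAlgorithm (max η ζ).toNNReal A
  else averageRateAlgorithm

section Analysis

variable {z : ℝ≥0} {B : ℕ}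

/-- The absolute differences of two workload vectors. -/
def absDiff (r w : Workload D T) : Workload D T := fun i ↦ (r i - w i) + (w i - r i)

lemma coe_absDiff (r w : Workload D T) (i) : (absDiff r w i : ℝ) = |(r i : ℝ) - w i| := by
  simp only [absDiff]
  rcases le_total (r i) (w i) with h | h
  · rw [tsub_eq_zero_of_le h, zero_add, NNReal.coe_sub h, abs_sub_comm, abs_of_nonneg]
    simpa using h
  · rw [tsub_eq_zero_of_le h, add_zero, NNReal.coe_sub h, abs_of_nonneg]
    simpa using h

lemma err_eq (α : ℝ) (r w : Workload D T) :
    err α r w = ((∑ i, absDiff r w i ^ α : ℝ≥0) : ℝ≥0∞) := by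
  rw [err, ENNReal.ofNNReal_finsetSum]
  refine Finset.sum_congr rfl fun i _ ↦ ?_
  rw [← coe_absDiff, ← NNReal.coe_rpow, ENNReal.ofReal_coe_nnreal]

lemma OPT_le_err {α : ℝ} (hα : 0 < α) (hD : 0 < D) (r w : Workload D T) :
    OPT α (absDiff r w) ≤ err α r w := by
  rw [err_eq, ENNReal.ofNNReal_finsetSum]
  refine (OPT_le_sum_rpow hα hD _).trans_eq (Finset.sum_congr rfl fun i _ ↦ ?_)
  rw [ENNReal.coe_rpow_of_nonneg _ hα.le]

lemma le_add_absDiff (r w : Workload D T) : r ≤ w + absDiff r w := fun i ↦ by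
  simp only [Pi.add_apply, absDiff, ← add_assoc]
  exact le_add_right le_add_tsub

lemma absDiff_comm (r w : Workload D T) : absDiff r w = absDiff w r :=
  funext fun _ ↦ add_comm _ _

lemma extend_le_add {u v w : Workload D T} (h : u ≤ v + w) (n : ℕ) :
    extend u n ≤ extend v n + extend w n := by
  unfold extend
  split_ifs
  · exact h _
  · simp

lemma IsNeighbor.exists_flow {η : ℝ} (hη : η ≤ z) {w pred : Workload D T}
    (h : IsNeighbor η w pred) :
    ∃ x : Fin (T - D + 1) → Fin (T - D + 1) → ℝ≥0,
      (∀ i j, x i j ≠ 0 → (i : ℕ) ≤ j + ⌊z * D⌋₊ ∧ (j : ℕ) ≤ i + ⌊z * D⌋₊) ∧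
      (∀ i, ∑ j, x i j = w i) ∧ (∀ j, ∑ i, x i j = pred j) := by
  obtain ⟨x, h1, h2, h3⟩ := h
  refine ⟨x, fun i j hx ↦ ?_, fun i ↦ (h2 i).symm, fun j ↦ (h3 j).symm⟩
  have h4 := not_lt.1 fun hlt ↦ hx (h1 i j hlt)
  have h5 : |((i : ℕ) : ℝ) - (j : ℕ)| < ⌊z * D⌋₊ + 1 := by
    have h6 : (z * D : ℝ≥0) < ⌊z * D⌋₊ + 1 := Nat.lt_floor_add_one _
    have h7 : (z * D : ℝ) < ⌊z * D⌋₊ + 1 := by exact_mod_cast h6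
    have h8 : η * D ≤ z * D := by gcongr
    linarith
  obtain ⟨h6, h7⟩ := abs_lt.1 h5
  have h8 : ((i : ℕ) : ℝ) < (j : ℕ) + ⌊z * D⌋₊ + 1 := by linarith
  have h9 : ((j : ℕ) : ℝ) < (i : ℕ) + ⌊z * D⌋₊ + 1 := by linarith
  norm_cast at h8 h9
  omega

/-- Moving work by at most `B` does not carry it over more than one block. -/
lemma cum_extend_le_of_flow {w w' : Workload D T} {x : Fin (T - D + 1) → Fin (T - D + 1) → ℝ≥0}
    (h : ∀ i j, x i j ≠ 0 → (j : ℕ) ≤ i + B) (h1 : ∀ i, ∑ j, x i j = w i)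
    (h2 : ∀ j, ∑ i, x i j = w' j) (k : ℕ) :
    cum (extend w) (k * B) ≤ cum (extend w') ((k + 1) * B) := by
  rw [cum_extend, cum_extend]
  calc ∑ i : Fin (T - D + 1), (if (i : ℕ) < k * B then w i else 0)
      ≤ ∑ i : Fin (T - D + 1), ∑ j : Fin (T - D + 1),
          if (j : ℕ) < (k + 1) * B then x i j else 0 := by
        refine Finset.sum_le_sum fun i _ ↦ ?_
        split_ifs with hi
        · rw [← h1 i]
          refine Finset.sum_le_sum fun j _ ↦ ?_
          split_ifs with hj
          · exact le_rfl
          · by_contra h0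
            have := h i j fun hx ↦ h0 hx.le
            linarith
        · exact zero_le
    _ = _ := by
        rw [Finset.sum_comm]
        refine Finset.sum_congr rfl fun j _ ↦ ?_
        split_ifs
        · exact h2 j
        · simp

/-- The excess of the matching over the capacity, as a workload vector. -/
noncomputable def excessWork (z : ℝ≥0) (B : ℕ) (pred real : Workload D T) :
    Workload (D - 4 * B) T :=
  fun m ↦ delay B (fun j ↦ excess z B (extend pred) (extend real) (j / B) / B) m

lemma matchedWork_le (pred real : Workload D T) :
    matchedWork z B pred real ≤ matchedPred z B pred + excessWork z B pred real := fun m ↦ by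
  simp only [matchedWork, matchedPred, excessWork, Pi.add_apply, delay]
  split_ifs
  · exact place_le z _ _ _
  · simp

lemma sum_excessWork_rpow_le {α : ℝ} (hα : 1 ≤ α) (hB : 0 < B) (hDT : D ≤ T) (hBD : 8 * B < D)
    (hz0 : z ≠ 0) (hz : z ≤ 1) {w pred : Workload D T} (real : Workload D T)
    {x : Fin (T - D + 1) → Fin (T - D + 1) → ℝ≥0}
    (hx : ∀ i j, x i j ≠ 0 → (i : ℕ) ≤ j + B ∧ (j : ℕ) ≤ i + B)
    (h1 : ∀ i, ∑ j, x i j = w i) (h2 : ∀ j, ∑ i, x i j = pred j) :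
    ∑ m, excessWork z B pred real m ^ α ≤ (32 / z) ^ α * ∑ i, absDiff real w i ^ α := by
  have hα0 : 0 < α := by linarith
  have hlen : T - D + 2 * B + 1 ≤ (T - D + 2 * B + 1) * B := Nat.le_mul_of_pos_right _ hB
  have hd : ∀ m, excessWork z B pred real m ^ α =
      delay B (fun j ↦ (excess z B (extend pred) (extend real) (j / B) / B) ^ α) m := fun m ↦ by
    simp only [excessWork, delay]
    split_ifs
    · rfl
    · exact NNReal.zero_rpow hα0.ne'
  simp only [hd]
  rw [sum_delay hDT hBD]
  refine (cum_mono _ hlen).trans ((sum_excess_div_rpow_le hα hB hz0 hz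
    (extend_le_add (le_add_absDiff real w)) (extend_le_add (v := real) (u := w) ?_)
    (cum_extend_le_of_flow (x := fun j i ↦ x i j) (fun j i h ↦ (hx i j h).1) h2 h1)
    (cum_extend_le_of_flow (fun i j h ↦ (hx i j h).2) h1 h2) _).trans_eq ?_)
  · rw [absDiff_comm]; exact le_add_absDiff w real
  · simp only [extend_rpow hα0]
    congr 1
    exact cum_extend_of_le _ (by omega)

lemma OPT_matchedWork_le {α : ℝ} (hα : 1 < α) (hB : 0 < B) (hDT : D ≤ T) (hBD : 8 * B < D)
    (pred real : Workload D T) :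
    OPT α (matchedWork z B pred real) ≤
      ENNReal.ofReal ((1 - 8 * B / D : ℝ)⁻¹ ^ (α - 1)) * OPT α real :=
  OPT_le_of_delay hα (by omega) hDT hB hBD (matchedFlow z B pred real)
    (sum_matchedFlow_slots pred real hB hDT hBD) (sum_matchedFlow_jobs pred real)
    fun _ _ ↦ matchedFlow_support pred real hB

/-- Moving the work of a neighbor `w` back to the prediction, delayed by two blocks, delays all work
by `B` at least and by `3 B` at most. -/
lemma OPT_matchedPred_le {α : ℝ} (hα : 1 < α) (hB : 0 < B) (hDT : D ≤ T) (hBD : 8 * B < D)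
    {w pred : Workload D T} {x : Fin (T - D + 1) → Fin (T - D + 1) → ℝ≥0}
    (hx : ∀ i j, x i j ≠ 0 → (i : ℕ) ≤ j + B ∧ (j : ℕ) ≤ i + B)
    (h1 : ∀ i, ∑ j, x i j = w i) (h2 : ∀ j, ∑ i, x i j = pred j) :
    OPT α (matchedPred z B pred) ≤ (1 + z : ℝ≥0∞) ^ α *
      (ENNReal.ofReal ((1 - 8 * B / D : ℝ)⁻¹ ^ (α - 1)) * OPT α w) := by
  have h3 : OPT α (fun m ↦ delay B (extend pred) m : Workload (D - 4 * B) T) ≤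
      ENNReal.ofReal ((1 - 8 * B / D : ℝ)⁻¹ ^ (α - 1)) * OPT α w := by
    refine OPT_le_of_delay hα (by omega) hDT hB hBD
      (fun i m ↦ delay B (extend (x i : Workload D T)) m) (fun i ↦ ?_) (fun m ↦ ?_) ?_
    · rw [sum_delay hDT hBD, cum_extend_of_le _ (by omega), h1]
    · simp only [delay]
      split_ifs
      · unfold extend
        split_ifs
        · exact h2 _
        · simp
      · simp
    · intro i m hne
      simp only [delay, extend] at hne
      split_ifs at hne with h4 h5
      · have := hx _ _ hne
        simp only at this
        omega
      · exact absurd rfl hne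
      · exact absurd rfl hne
  have h4 : matchedPred z B pred = (fun m ↦ (1 + z) * delay B (extend pred) m :
      Workload (D - 4 * B) T) := by
    ext m
    simp only [matchedPred, delay]
    split_ifs <;> simp
  rw [h4]
  refine (OPT_const_mul_le (by linarith) (by positivity) _).trans ?_
  push_cast
  gcongr

/-- The loss from shrinking the windows: `1 / (1 - 8 z) ≤ 1 + 16 z ≤ (1 + z) ^ 16` for
`z ≤ 1 / 16`. -/
lemma inv_rpow_le {α : ℝ} (hα : 1 < α) (hz : z < 1 / 16) {q : ℝ} (hq : q ≤ 8 * z) :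
    ENNReal.ofReal ((1 - q)⁻¹ ^ (α - 1)) ≤ ((1 + z : ℝ≥0∞) ^ α) ^ 16 := by
  have hz' : (z : ℝ) < 1 / 16 := by exact_mod_cast hz
  have hz0 : (0 : ℝ) ≤ z := z.2
  have h1 : 0 < 1 - q := by linarith
  have h2 : (1 - q)⁻¹ ≤ (1 + z : ℝ) ^ 16 := by
    calc (1 - q)⁻¹ ≤ 1 + 16 * z := by
          rw [inv_le_iff_one_le_mul₀ h1]
          nlinarith
      _ ≤ (1 + z) ^ 16 := by
          have := one_add_mul_le_pow (a := (z : ℝ)) (by linarith) 16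
          simpa using this
  have h3 : (1 : ℝ) ≤ (1 + z) ^ 16 := one_le_pow₀ (by linarith)
  calc ENNReal.ofReal ((1 - q)⁻¹ ^ (α - 1))
      ≤ ENNReal.ofReal (((1 + z : ℝ) ^ 16) ^ α) := by
        refine ENNReal.ofReal_le_ofReal ?_
        exact (Real.rpow_le_rpow (inv_pos.2 h1).le h2 (by linarith)).trans
          (Real.rpow_le_rpow_of_exponent_le h3 (by linarith))
    _ = ((1 + z : ℝ≥0∞) ^ α) ^ 16 := by
        rw [← ENNReal.ofReal_rpow_of_nonneg (by positivity) (by linarith),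
          ENNReal.ofReal_pow (by positivity), ENNReal.ofReal_add zero_le_one hz0,
          ENNReal.ofReal_one, ENNReal.ofReal_coe_nnreal, ← ENNReal.rpow_natCast,
          ← ENNReal.rpow_natCast, ← ENNReal.rpow_mul, ← ENNReal.rpow_mul, mul_comm]

lemma error_factor_le {α : ℝ} (hα : 1 < α) (hz0 : z ≠ 0) (hz : z < 1 / 16) :
    (1 + (z : ℝ≥0∞)⁻¹) ^ α + (1 + (z : ℝ≥0∞)⁻¹) ^ α * ((32 / z) ^ α : ℝ≥0) ≤
      (((z : ℝ≥0∞)⁻¹) ^ α) ^ 4 := by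
  have hα0 : 0 ≤ α := by linarith
  have hy : 16 ≤ z⁻¹ := by
    rw [le_inv_comm₀ (by norm_num) (pos_iff_ne_zero.2 hz0)]
    simpa using hz.le
  rw [← ENNReal.coe_inv hz0, ← ENNReal.coe_one, ← ENNReal.coe_add,
    ← ENNReal.coe_rpow_of_nonneg _ hα0, ← ENNReal.coe_rpow_of_nonneg _ hα0, div_eq_mul_inv]
  norm_cast
  generalize z⁻¹ = y at *
  have h1 : (1 : ℝ≥0) ≤ (32 * y) ^ α := by
    refine NNReal.one_le_rpow ?_ hα0
    calc (1 : ℝ≥0) ≤ 32 * 16 := by norm_num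
      _ ≤ 32 * y := by gcongr
  have h2 : (2 : ℝ≥0) ≤ 2 ^ α := by
    simpa using NNReal.rpow_le_rpow_of_exponent_le (x := 2) (by norm_num) hα.le
  have h3 : (1 + y) ^ α ≤ (2 * y) ^ α := by
    refine NNReal.rpow_le_rpow ?_ hα0
    rw [two_mul]
    gcongr
    exact le_trans (by norm_num) hy
  calc (1 + y) ^ α + (1 + y) ^ α * (32 * y) ^ α
      ≤ (2 * y) ^ α * (32 * y) ^ α + (2 * y) ^ α * (32 * y) ^ α := by
        gcongr
        exact h3.trans (le_mul_of_one_le_right zero_le h1)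
    _ = 2 * ((2 * y) ^ α * (32 * y) ^ α) := (two_mul _).symm
    _ ≤ 2 ^ α * ((2 * y) ^ α * (32 * y) ^ α) := by gcongr
    _ = (128 * y ^ 2) ^ α := by
        rw [← NNReal.mul_rpow, ← NNReal.mul_rpow]
        congr 1
        ring
    _ ≤ (y ^ 4) ^ α := by
        refine NNReal.rpow_le_rpow ?_ hα0
        calc 128 * y ^ 2 ≤ 16 ^ 2 * y ^ 2 := by gcongr; norm_num
          _ ≤ y ^ 2 * y ^ 2 := by gcongr
          _ = y ^ 4 := by ring
    _ = (y ^ α) ^ 4 := by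
        rw [← NNReal.rpow_natCast, ← NNReal.rpow_natCast, ← NNReal.rpow_mul, ← NNReal.rpow_mul,
          mul_comm]

/-- The cost for the moved work is at most the cost for the increased prediction plus the excess,
which differs from the prediction that `A` is given by the excess only. -/
lemma cost_matchedSchedule_le {α : ℝ} (hα : 1 < α) {A : OnlineAlgorithm} (hmono : A.IsMonotone α)
    {C C' C'' : ℝ≥0} (hA : A.HasGuarantee α C C' C'') (hz0 : z ≠ 0) (hz : z < 1 / 16)
    (hB : 0 < B) (hBz : (B : ℝ) ≤ z * D) (hDT : D ≤ T) {w pred : Workload D T}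
    (real : Workload D T) {x : Fin (T - D + 1) → Fin (T - D + 1) → ℝ≥0}
    (hx : ∀ i j, x i j ≠ 0 → (i : ℕ) ≤ j + B ∧ (j : ℕ) ≤ i + B)
    (h1 : ∀ i, ∑ j, x i j = w i) (h2 : ∀ j, ∑ i, x i j = pred j) (hBD : 8 * B < D) :
    cost α (matchedSchedule z B A pred real) ≤ ((1 + z : ℝ≥0∞) ^ α) ^ 20 *
      min (C * OPT α real + (((z : ℝ≥0∞)⁻¹) ^ α) ^ 4 * (C + C') * err α real w)
        (C'' * OPT α real) := by
  have hα0 : 0 < α := by linarith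
  have hD : 0 < D := by omega
  have hD0 : (0 : ℝ) < D := by exact_mod_cast hD
  have hD' : 0 < D - 4 * B := by omega
  have hDT' : D - 4 * B ≤ T := by omega
  set X := (1 + z : ℝ≥0∞) ^ α with hX
  set Q := (1 + (z : ℝ≥0∞)⁻¹) ^ α with hQ
  set R : ℝ≥0∞ := (((32 / z) ^ α : ℝ≥0) : ℝ≥0∞) with hR
  set Y := ((z : ℝ≥0∞)⁻¹) ^ α with hY
  set e := err α real w with he
  have hX1 : 1 ≤ X := ENNReal.one_le_rpow le_self_add hα0
  have hQ1 : 1 ≤ Q := ENNReal.one_le_rpow le_self_add hα0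
  have hQR : Q + Q * R ≤ Y ^ 4 := error_factor_le hα hz0 hz
  have hRY : R ≤ Y ^ 4 := le_trans (le_add_left (le_mul_of_one_le_left zero_le hQ1)) hQR
  have hG : ENNReal.ofReal ((1 - 8 * B / D : ℝ)⁻¹ ^ (α - 1)) ≤ X ^ 16 := by
    refine inv_rpow_le hα hz ?_
    rw [div_le_iff₀ hD0]
    linarith
  have hcost : cost α (matchedSchedule z B A pred real) ≤
      cost α (A.run (D - 4 * B) T (matchedPred z B pred) (matchedWork z B pred real)) := by
    rw [(A.feasible (D - 4 * B) T hD' hDT' _ _).cost_eq hα0 hDT']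
    exact cost_resplit_le hα0.le _ fun m ↦ (sum_matchedFlow_jobs pred real m).le
  have hOw : OPT α w ≤ X * OPT α real + Q * e := by
    refine (OPT_mono hα0 hDT (le_add_absDiff w real)).trans
      ((OPT_add_le hα0 hz0 real (absDiff w real)).trans ?_)
    rw [absDiff_comm]
    gcongr
    exact OPT_le_err hα0 hD real w
  have hU : ((∑ m, excessWork z B pred real m ^ α : ℝ≥0) : ℝ≥0∞) ≤ R * e := by
    rw [he, err_eq, hR, ← ENNReal.coe_mul]
    exact_mod_cast sum_excessWork_rpow_le hα.le hB hDT hBD hz0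
      (hz.le.trans (by rw [div_le_one] <;> norm_num)) real hx h1 h2
  have hOU : OPT α (excessWork z B pred real) ≤ R * e := by
    refine (OPT_le_sum_rpow hα0 hD' _).trans (le_trans (le_of_eq ?_) hU)
    rw [ENNReal.ofNNReal_finsetSum]
    exact Finset.sum_congr rfl fun i _ ↦ (ENNReal.coe_rpow_of_nonneg _ hα0.le).symm
  have herr : err α (matchedPred z B pred + excessWork z B pred real) (matchedPred z B pred) ≤
      R * e := by
    rw [err_eq]
    refine le_trans (le_of_eq ?_) hU
    refine congrArg _ (Finset.sum_congr rfl fun i _ ↦ ?_)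
    simp only [absDiff, Pi.add_apply, add_tsub_cancel_left, tsub_eq_zero_of_le le_self_add,
      add_zero]
  have hOPT : OPT α (matchedPred z B pred + excessWork z B pred real) ≤
      X * (X * (X ^ 16 * (X * OPT α real + Q * e))) + Q * (R * e) := by
    refine (OPT_add_le hα0 hz0 _ _).trans ?_
    gcongr
    refine (OPT_matchedPred_le hα hB hDT hBD hx h1 h2).trans ?_
    gcongr
  rw [mul_min]
  refine hcost.trans (le_min ?_ ?_)
  · calc cost α (A.run (D - 4 * B) T (matchedPred z B pred) (matchedWork z B pred real))
        ≤ cost α (A.run (D - 4 * B) T (matchedPred z B pred)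
            (matchedPred z B pred + excessWork z B pred real)) :=
          hmono _ _ hD' hDT' _ _ _ (matchedWork_le pred real)
      _ ≤ C * (X * (X * (X ^ 16 * (X * OPT α real + Q * e))) + Q * (R * e)) + C' * (R * e) := by
          refine (hA _ _ hD' hDT' _ _).trans ((min_le_left _ _).trans ?_)
          gcongr
      _ = X ^ 19 * (C * OPT α real) + (X ^ 18 * (C * (Q * e)) + 1 * (C * (Q * R * e)) +
            1 * (C' * (R * e))) := by ring
      _ ≤ X ^ 20 * (C * OPT α real) + (X ^ 20 * (C * (Q * e)) + X ^ 20 * (C * (Q * R * e)) +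
            X ^ 20 * (C' * (R * e))) := by
          gcongr
          · norm_num
          · norm_num
          · exact one_le_pow₀ hX1
          · exact one_le_pow₀ hX1
      _ = X ^ 20 * (C * OPT α real + (C * (Q + Q * R) + C' * R) * e) := by ring
      _ ≤ X ^ 20 * (C * OPT α real + (C * Y ^ 4 + C' * Y ^ 4) * e) := by gcongr
      _ = X ^ 20 * (C * OPT α real + Y ^ 4 * (C + C') * e) := by ring
  · calc cost α (A.run (D - 4 * B) T (matchedPred z B pred) (matchedWork z B pred real))
        ≤ C'' * OPT α (matchedWork z B pred real) :=
          (hA _ _ hD' hDT' _ _).trans (min_le_right _ _)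
      _ ≤ C'' * (X ^ 20 * OPT α real) := by
          gcongr
          refine (OPT_matchedWork_le hα hB hDT hBD pred real).trans ?_
          gcongr
          exact hG.trans (pow_le_pow_right₀ hX1 (by norm_num))
      _ = X ^ 20 * (C'' * OPT α real) := by ring

lemma cost_matchingAlgorithm_le {α : ℝ} (hα : 1 < α) {A : OnlineAlgorithm}
    (hmono : A.IsMonotone α) {C C' C'' : ℝ≥0} (hA : A.HasGuarantee α C C' C'') (hz0 : z ≠ 0)
    (hz : z < 1 / 16) {η : ℝ} (hη : η ≤ z) (hD : 0 < D) (hDT : D ≤ T) {w pred : Workload D T}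
    (hw : IsNeighbor η w pred) (real : Workload D T) :
    cost α ((matchingAlgorithm z A).run D T pred real) ≤ ((1 + z : ℝ≥0∞) ^ α) ^ 20 *
      min (C * OPT α real + (((z : ℝ≥0∞)⁻¹) ^ α) ^ 4 * (C + C') * err α real w)
        (C'' * OPT α real) := by
  have hα0 : 0 < α := by linarith
  obtain ⟨x, hx, h1, h2⟩ := hw.exists_flow hη
  have hfl : (⌊z * D⌋₊ : ℝ≥0) ≤ z * D := Nat.floor_le zero_le
  have hfl' : (⌊z * D⌋₊ : ℝ) ≤ z * D := by exact_mod_cast hfl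
  have hlt : 8 * ⌊z * D⌋₊ < D := by
    have hz' : (z : ℝ) < 1 / 16 := by exact_mod_cast hz
    have hD0 : (0 : ℝ) < D := by exact_mod_cast hD
    have : (8 * ⌊z * D⌋₊ : ℝ) < D := by nlinarith
    exact_mod_cast this
  rcases Nat.eq_zero_or_pos ⌊z * D⌋₊ with hB | hB
  · have hwp : w = pred := by
      have hd : ∀ i j, x i j ≠ 0 → i = j := fun i j h ↦ by
        have := hx i j h
        exact Fin.ext (by omega)
      ext k
      rw [← h1, ← h2, Finset.sum_eq_single k, Finset.sum_eq_single k]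
      · exact fun i _ hi ↦ by_contra fun h ↦ hi (hd _ _ h)
      · simp
      · exact fun i _ hi ↦ by_contra fun h ↦ hi (hd _ _ h).symm
      · simp
    subst hwp
    have hX1 : 1 ≤ ((1 + z : ℝ≥0∞) ^ α) ^ 20 :=
      one_le_pow₀ (ENNReal.one_le_rpow le_self_add hα0)
    have hY1 : 1 ≤ (((z : ℝ≥0∞)⁻¹) ^ α) ^ 4 := by
      refine one_le_pow₀ (ENNReal.one_le_rpow ?_ hα0)
      rw [ENNReal.one_le_inv]
      have : (1 : ℝ≥0) / 16 ≤ 1 := by rw [div_le_one] <;> norm_num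
      exact_mod_cast hz.le.trans this
    simp only [matchingAlgorithm, hB, lt_irrefl, false_and, if_false]
    refine (hA D T hD hDT w real).trans (le_trans ?_ (le_mul_of_one_le_left zero_le hX1))
    gcongr
    exact le_mul_of_one_le_of_le hY1 le_add_self
  · simp only [matchingAlgorithm, hB, hlt, true_and, if_true]
    exact cost_matchedSchedule_le hα hmono hA hz0 hz hB hfl' hDT real hx h1 h2 hlt

lemma isNeighbor_self {η : ℝ} (hη : 0 ≤ η) (w : Workload D T) : IsNeighbor η w w := by
  refine ⟨fun i j ↦ if i = j then w i else 0, fun i j h ↦ if_neg ?_, fun i ↦ by simp,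
    fun j ↦ by simp⟩
  rintro rfl
  have : 0 ≤ η * D := by positivity
  simp at h
  linarith

/-- A bound that holds for the error with respect to every neighbor of the prediction holds for the
`η`-prediction error. -/
lemma le_errShift_of_le {α η : ℝ} {real pred : Workload D T} {y k a b c : ℝ≥0∞}
    (hk0 : k ≠ 0) (hk : k ≠ ∞) (hc0 : c ≠ 0) (hc : c ≠ ∞)
    (h : ∀ w, IsNeighbor η w pred → y ≤ k * min (a + c * err α real w) b)
    (hne : ∃ w, IsNeighbor η w pred) :
    y ≤ k * min (a + c * errShift α η real pred) b := by
  obtain ⟨w₀, hw₀⟩ := hne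
  rw [mul_min]
  refine le_min ?_ ((h w₀ hw₀).trans (by gcongr; exact min_le_right _ _))
  rw [errShift, ENNReal.mul_iInf_of_ne hc0 hc, ENNReal.add_iInf, ENNReal.mul_iInf_of_ne hk0 hk]
  refine le_iInf fun w ↦ ?_
  rw [ENNReal.mul_iInf_of_ne hc0 hc, ENNReal.add_iInf, ENNReal.mul_iInf_of_ne hk0 hk]
  exact le_iInf fun hw ↦ (h w hw).trans (by gcongr; exact min_le_left _ _)

lemma cost_noiseRobust_le {α : ℝ} (hα : 1 < α) {A : OnlineAlgorithm}
    (hmono : A.IsMonotone α) {C C' C'' : ℝ≥0} (hA : A.HasGuarantee α C C' C'') {η ζ : ℝ}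
    (hη : 0 ≤ η) (hζ : 0 < ζ) (hD : 0 < D) (hDT : D ≤ T) (pred real : Workload D T) :
    cost α ((noiseRobust η ζ A).run D T pred real) ≤
      ENNReal.ofReal (((1 + η) * (1 + ζ)) ^ (20 * α)) *
        min (C * OPT α real + ENNReal.ofReal ((1 / ζ) ^ (4 * α)) * (C + C') *
          errShift α η real pred) (C'' * OPT α real) := by
  have hα0 : 0 < α := by linarith
  obtain ⟨hC, hC''⟩ := hA.one_le hα
  have hC0 : (C : ℝ≥0∞) ≠ 0 := by
    have : C ≠ 0 := (one_pos.trans_le hC).ne'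
    exact_mod_cast this
  have hz0 : 0 < max η ζ := lt_max_of_lt_right hζ
  set z := (max η ζ).toNNReal with hz
  have hzc : (z : ℝ) = max η ζ := Real.coe_toNNReal _ hz0.le
  have hle : 1 + max η ζ ≤ (1 + η) * (1 + ζ) := by
    have := mul_nonneg hη hζ.le
    have := max_le (by linarith : η ≤ (1 + η) * (1 + ζ) - 1)
      (by linarith : ζ ≤ (1 + η) * (1 + ζ) - 1)
    linarith
  have hF : ∀ q : ℝ≥0, (q : ℝ) ≤ ((1 + η) * (1 + ζ)) ^ (20 : ℕ) →
      (q : ℝ≥0∞) ^ α ≤ ENNReal.ofReal (((1 + η) * (1 + ζ)) ^ (20 * α)) := by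
    intro q hq
    rw [Real.rpow_mul (by positivity), ← ENNReal.ofReal_rpow_of_nonneg (by positivity) hα0.le]
    gcongr
    rw [← ENNReal.ofReal_coe_nnreal]
    exact ENNReal.ofReal_le_ofReal (by exact_mod_cast hq)
  rw [noiseRobust, ← hz]
  split_ifs with hsmall
  · refine le_errShift_of_le ?_ (by simp) ?_ ?_ (fun w hw ↦ ?_)
      ⟨pred, isNeighbor_self hη pred⟩
    · simp only [ne_eq, ENNReal.ofReal_eq_zero, not_le]
      positivity
    · refine mul_ne_zero ?_ (by simp [hC0])
      simp only [ne_eq, ENNReal.ofReal_eq_zero, not_le]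
      positivity
    · exact ENNReal.mul_ne_top (by simp) (by simp)
    · refine (cost_matchingAlgorithm_le hα hmono hA (z := z)
        (Real.toNNReal_pos.2 hz0).ne' hsmall
        (hzc ▸ le_max_left η ζ) hD hDT hw real).trans ?_
      gcongr
      · have := hF ((1 + z) ^ 20) (by push_cast; rw [hzc]; gcongr)
        refine le_trans (le_of_eq ?_) this
        push_cast
        rw [← ENNReal.rpow_natCast, ← ENNReal.rpow_natCast, ← ENNReal.rpow_mul,
          ← ENNReal.rpow_mul, mul_comm]
      · rw [mul_comm 4 α, Real.rpow_mul (by positivity),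
          ← ENNReal.ofReal_rpow_of_nonneg (by positivity) (by norm_num),
          ← ENNReal.ofReal_rpow_of_nonneg (by positivity) hα0.le, ENNReal.rpow_ofNat]
        gcongr
        rw [one_div, ENNReal.ofReal_inv_of_pos hζ, ENNReal.inv_le_inv,
          ← ENNReal.ofReal_coe_nnreal, hzc]
        exact ENNReal.ofReal_le_ofReal (le_max_right _ _)
  · have h1 : (1 : ℝ) / 16 ≤ max η ζ := by
      rw [← hzc]
      exact_mod_cast not_lt.1 hsmall
    -- the exponent is such that `(1 + 1 / 16) ^ 20 ≥ 2`
    have h2 := hF 2 (by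
      calc ((2 : ℝ≥0) : ℝ) ≤ (1 + 1 / 16) ^ 20 := by norm_num
        _ ≤ _ := by gcongr; linarith)
    refine (cost_averageRate_le hα hD hDT real).trans ?_
    refine mul_le_mul' (by exact_mod_cast h2) (le_min (le_add_right ?_) ?_)
    · exact le_mul_of_one_le_left zero_le (by exact_mod_cast hC)
    · exact le_mul_of_one_le_left zero_le (by exact_mod_cast hC'')

end Analysis

end SpeedScaling

theorem mainTheorem10 :
    ∃ c₁ c₂ : ℝ, 0 < c₁ ∧ 0 < c₂ ∧
      ∃ NoiseRobust : (η ζ : ℝ) → SpeedScaling.OnlineAlgorithm → SpeedScaling.OnlineAlgorithm,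
        ∀ α : ℝ, 1 < α →
        ∀ A : SpeedScaling.OnlineAlgorithm, A.IsMonotone α →
        ∀ C C' C'' : ℝ≥0, A.HasGuarantee α C C' C'' →
        ∀ η ζ : ℝ, 0 ≤ η → 0 < ζ →
        ∀ D T : ℕ, 0 < D → D ≤ T →
        ∀ pred real : SpeedScaling.Workload D T,
          SpeedScaling.cost α ((NoiseRobust η ζ A).run D T pred real) ≤
            ENNReal.ofReal (((1 + η) * (1 + ζ)) ^ (c₁ * α)) *
              min ((C : ℝ≥0∞) * SpeedScaling.OPT α real +
                    ENNReal.ofReal ((1 / ζ) ^ (c₂ * α)) * ((C : ℝ≥0∞) + (C' : ℝ≥0∞)) *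
                      SpeedScaling.errShift α η real pred)
                ((C'' : ℝ≥0∞) * SpeedScaling.OPT α real) := by
  refine ⟨20, 4, by norm_num, by norm_num, SpeedScaling.noiseRobust, ?_⟩
  intro α hα A hmono C C' C'' hA η ζ hη hζ D T hD hDT pred real
  exact SpeedScaling.cost_noiseRobust_le hα hmono hA hη hζ hD hDT pred real
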